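/- Let $\Bbbk$ be a field. Let $Ch_{\geq 0}(\Bbbk)$ be the category of non-negatively graded chain complexes of $\Bbbk$-vector spaces, with tensor product $(V\otimes W)_n=\bigoplus_{p+q=n}V_p\otimes W_q$, $d(x\otimes y)=dx\otimes y+(-1)^{p}x\otimes dy$ for $x\in V_p$, and switch $x\otimes y\mapsto(-1)^{pq}y\otimes x$ for $x\in V_p$, $y\in W_q$. Let $CDGC$ be the category of coassociative, counital, cocommutative coalgebras in $Ch_{\geq 0}(\Bbbk)$. Then the forgetful functor $U: CDGC\to Ch_{\geq 0}(\Bbbk)$ has a right adjoint $C: Ch_{\geq 0}(\Bbbk)\to CDGC$. Moreover $C$ has the following description. (1) Let $V$ be of finite total dimension. Let $V^\vee$ be its linear dual, a non-positively graded complex, and let $\Lambda V^\vee$ be the free graded commutative differential algebra on $V^\vee$, that is, the tensor algebra modulo the relations $xy=(-1)^{|x||y|}yx$. The homogeneous differential ideals $I\subseteq\Lambda V^\vee$ of finite codimension, with the inclusions reversed, form a filtered diagram, and $$C(V)=\operatorname{colim}_I\,(\Lambda V^\vee/I)^\vee\quad\text{in } CDGC,$$ where $(\Lambda V^\vee/I)^\vee$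 is the coalgebra dual to the finite-dimensional algebra $\Lambda V^\vee/I$, the transition maps are the transposes of the quotient maps $\Lambda V^\vee/I\to\Lambda V^\vee/J$ for $I\subseteq J$, and the structure maps $(\Lambda V^\vee/I)^\vee\to C(V)$ of the colimit are adjoint to the transposes $(\Lambda V^\vee/I)^\vee\to V^{\vee\vee}\cong V$ of the canonical maps $V^\vee\to\Lambda V^\vee\to\Lambda V^\vee/I$. (2) Let $V$ be arbitrary. The subcomplexes $V_\alpha\subseteq V$ of finite total dimension form a filtered diagram under inclusion, and the maps $C(V_\alpha)\to C(V)$ induced by the inclusions exhibit $C(V)=\operatorname{colim}_\alpha C(V_\alpha)$ in $CDGC$. -/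

import Mathlib

open CategoryTheory CategoryTheory.Limits Opposite
open scoped TensorProduct DirectSum

noncomputable section

universe u

/-! ### Differential graded cocommutative coalgebras -/

/-- A counital cocommutative coalgebra in non-negatively graded chain complexes over `k`.
Since `(X ⊗ X)ₙ` is the finite direct sum of the `Xₚ ⊗ X_q` with `p + q = n`, a degree-preserving
map `Δ : X → X ⊗ X` is given by its components `comul p q n h : Xₙ → Xₚ ⊗ X_q`, and a
degree-preserving map `X → k` by its component in degree `0`. The axioms are those of a
coassociative, counital comonoid, invariance of `Δ` under the switch
`x ⊗ y ↦ (-1)^{pq} y ⊗ x`, and compatibility of `Δ` and of the counit with the differentials, where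
`d (x ⊗ y) = d x ⊗ y + (-1)^p x ⊗ d y` for `x` of degree `p`. -/
structure CDGC (k : Type u) [Field k] where
  X : ChainComplex (ModuleCat.{u} k) ℕ
  comul (p q n : ℕ) (h : p + q = n) : X.X n →ₗ[k] X.X p ⊗[k] X.X q
  counit : X.X 0 →ₗ[k] k
  coassoc : ∀ (p q r m l n : ℕ) (h₁ : p + q = m) (h₂ : m + r = n) (h₃ : q + r = l)
    (h₄ : p + l = n) (x : X.X n),
    TensorProduct.assoc k (X.X p) (X.X q) (X.X r)
        ((comul p q m h₁).rTensor (X.X r) (comul m r n h₂ x)) =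
      (comul q r l h₃).lTensor (X.X p) (comul p l n h₄ x)
  counit_comul : ∀ (n : ℕ) (x : X.X n),
    TensorProduct.lid k (X.X n) (counit.rTensor (X.X n) (comul 0 n n (Nat.zero_add n) x)) = x
  comul_counit : ∀ (n : ℕ) (x : X.X n),
    TensorProduct.rid k (X.X n) (counit.lTensor (X.X n) (comul n 0 n (Nat.add_zero n) x)) = x
  cocomm : ∀ (p q n : ℕ) (h : p + q = n) (h' : q + p = n) (x : X.X n),
    TensorProduct.comm k (X.X p) (X.X q) (comul p q n h x) = (-1 : k) ^ (p * q) • comul q p n h' x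
  comul_d : ∀ (p q n : ℕ) (h : p + q = n) (h₁ : (p + 1) + q = n + 1) (h₂ : p + (q + 1) = n + 1)
    (x : X.X (n + 1)),
    comul p q n h ((X.d (n + 1) n).hom x) =
      (X.d (p + 1) p).hom.rTensor (X.X q) (comul (p + 1) q (n + 1) h₁ x) +
        (-1 : k) ^ p • (X.d (q + 1) q).hom.lTensor (X.X p) (comul p (q + 1) (n + 1) h₂ x)
  counit_d : ∀ x : X.X 1, counit ((X.d 1 0).hom x) = 0

namespace CDGC

variable {k : Type u} [Field k]

/-- A morphism of differential graded coalgebras: a chain map commuting with the comultiplications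
and the counits. -/
@[ext]
structure Hom (C D : CDGC k) where
  f : C.X ⟶ D.X
  map_comul : ∀ (p q n : ℕ) (h : p + q = n) (x : C.X.X n),
    D.comul p q n h ((f.f n).hom x) =
      TensorProduct.map (f.f p).hom (f.f q).hom (C.comul p q n h x)
  map_counit : ∀ x : C.X.X 0, D.counit ((f.f 0).hom x) = C.counit x

instance : Category (CDGC k) where
  Hom := Hom
  id C :=
    { f := 𝟙 C.X
      map_comul := fun p q n h x => by simp
      map_counit := fun x => by simp }
  comp {C D E} f g :=
    { f := f.f ≫ g.f
      map_comul := fun p q n h x => by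
        simp only [HomologicalComplex.comp_f, ModuleCat.hom_comp, LinearMap.comp_apply]
        rw [g.map_comul, f.map_comul, TensorProduct.map_comp, LinearMap.comp_apply]
      map_counit := fun x => by
        simp only [HomologicalComplex.comp_f, ModuleCat.hom_comp, LinearMap.comp_apply]
        rw [g.map_counit, f.map_counit] }
  id_comp f := Hom.ext (Category.id_comp f.f)
  comp_id f := Hom.ext (Category.comp_id f.f)
  assoc f g h := Hom.ext (Category.assoc f.f g.f h.f)

/-- The forgetful functor from cocommutative coalgebras to chain complexes. -/
def forget (k : Type u) [Field k] : CDGC k ⥤ ChainComplex (ModuleCat.{u} k) ℕ where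
  obj C := C.X
  map f := f.f
  map_id _ := rfl
  map_comp _ _ := rfl

end CDGC

/-! ### Differential graded commutative algebras -/

/-- A unital commutative algebra in non-positively graded chain complexes over `k`. The component
`X.X n` of the underlying cochain complex sits in chain degree `-n`; the differential lowers the
chain degree by one and is a graded derivation, and `a b = (-1)^{pq} b a`. -/
structure CDGA (k : Type u) [Field k] where
  X : CochainComplex (ModuleCat.{u} k) ℕ
  mul (p q n : ℕ) (h : p + q = n) : X.X p →ₗ[k] X.X q →ₗ[k] X.X n
  one : X.X 0
  mul_assoc : ∀ (p q r m l n : ℕ) (h₁ : p + q = m) (h₂ : m + r = n) (h₃ : q + r = l)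
    (h₄ : p + l = n) (a : X.X p) (b : X.X q) (c : X.X r),
    mul m r n h₂ (mul p q m h₁ a b) c = mul p l n h₄ a (mul q r l h₃ b c)
  one_mul : ∀ (n : ℕ) (a : X.X n), mul 0 n n (Nat.zero_add n) one a = a
  mul_one : ∀ (n : ℕ) (a : X.X n), mul n 0 n (Nat.add_zero n) a one = a
  mul_comm : ∀ (p q n : ℕ) (h : p + q = n) (h' : q + p = n) (a : X.X p) (b : X.X q),
    mul p q n h a b = (-1 : k) ^ (p * q) • mul q p n h' b a
  leibniz : ∀ (p q n : ℕ) (h : p + q = n) (h₁ : (p + 1) + q = n + 1) (h₂ : p + (q + 1) = n + 1)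
    (a : X.X p) (b : X.X q),
    (X.d n (n + 1)).hom (mul p q n h a b) =
      mul (p + 1) q (n + 1) h₁ ((X.d p (p + 1)).hom a) b +
        (-1 : k) ^ p • mul p (q + 1) (n + 1) h₂ a ((X.d q (q + 1)).hom b)

/-- The total space `⨁ n, M n` of a graded vector space is finite-dimensional. -/
def IsTotallyFinite (k : Type u) [Field k] (M : ℕ → Type u) [∀ n, AddCommGroup (M n)]
    [∀ n, Module k (M n)] : Prop :=
  Module.Finite k (⨁ n, M n)

theorem IsTotallyFinite.finite {k : Type u} [Field k] {M : ℕ → Type u} [∀ n, AddCommGroup (M n)]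
    [∀ n, Module k (M n)] (h : IsTotallyFinite k M) (n : ℕ) : Module.Finite k (M n) := by
  have : Module.Finite k (⨁ n, M n) := h
  exact Module.Finite.of_surjective (DirectSum.component k ℕ M n)
    (fun x => ⟨DirectSum.lof k ℕ M n x, DirectSum.component.lof_self k n x⟩)

/-- The total space of a complex of vector spaces is finite-dimensional. -/
def HomologicalComplex.IsFiniteDim {k : Type u} [Field k] {c : ComplexShape ℕ}
    (V : HomologicalComplex (ModuleCat.{u} k) c) : Prop :=
  IsTotallyFinite k (fun n => V.X n)

theorem HomologicalComplex.IsFiniteDim.finite {k : Type u} [Field k] {c : ComplexShape ℕ}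
    {V : HomologicalComplex (ModuleCat.{u} k) c} (h : V.IsFiniteDim) (n : ℕ) :
    Module.Finite k (V.X n) := 
  IsTotallyFinite.finite h n

theorem HomologicalComplex.d_hom_d_hom {k : Type u} [Field k] {c : ComplexShape ℕ}
    (V : HomologicalComplex (ModuleCat.{u} k) c) (i j l : ℕ) (x : V.X i) :
    (V.d j l).hom ((V.d i j).hom x) = 0 := by
  rw [← ModuleCat.comp_apply, V.d_comp_d]
  rfl

namespace CDGA

variable {k : Type u} [Field k]

/-- A morphism of differential graded algebras. -/
@[ext]
structure Hom (A B : CDGA k) where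
  f : A.X ⟶ B.X
  map_mul : ∀ (p q n : ℕ) (h : p + q = n) (a : A.X.X p) (b : A.X.X q),
    (f.f n).hom (A.mul p q n h a b) = B.mul p q n h ((f.f p).hom a) ((f.f q).hom b)
  map_one : (f.f 0).hom A.one = B.one

instance : Category (CDGA k) where
  Hom := Hom
  id A :=
    { f := 𝟙 A.X
      map_mul := fun p q n h a b => by simp
      map_one := by simp }
  comp {A B C} f g :=
    { f := f.f ≫ g.f
      map_mul := fun p q n h a b => by simp [f.map_mul, g.map_mul]
      map_one := by simp [f.map_one, g.map_one] }
  id_comp f := Hom.ext (Category.id_comp f.f)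
  comp_id f := Hom.ext (Category.comp_id f.f)
  assoc f g h := Hom.ext (Category.assoc f.f g.f h.f)

end CDGA

/-! ### Linear duals -/

namespace ChainComplex

variable {k : Type u} [Field k]

/-- The linear dual of a non-negatively graded complex, a non-positively graded one:
`(V^∨)_{-n} = Hom(Vₙ, k)` with the transposed differential `f ↦ f ∘ d`. -/
def linearDual (V : ChainComplex (ModuleCat.{u} k) ℕ) : CochainComplex (ModuleCat.{u} k) ℕ where
  X n := ModuleCat.of k (Module.Dual k (V.X n))
  d i j := ModuleCat.ofHom (V.d j i).hom.dualMap
  shape i j h := by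
    rw [V.shape j i h]
    ext f
    simp
  d_comp_d' i j l _ _ := by
    ext f x
    change f ((V.d j i).hom ((V.d l j).hom x)) = 0
    rw [V.d_hom_d_hom, map_zero]

end ChainComplex

namespace CochainComplex

variable {k : Type u} [Field k]

/-- The linear dual of a non-positively graded complex, with the transposed differential. -/
def linearDual (V : CochainComplex (ModuleCat.{u} k) ℕ) : ChainComplex (ModuleCat.{u} k) ℕ where
  X n := ModuleCat.of k (Module.Dual k (V.X n))
  d i j := ModuleCat.ofHom (V.d j i).hom.dualMap
  shape i j h := by
    rw [V.shape j i h]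
    ext f
    simp
  d_comp_d' i j l _ _ := by
    ext f x
    change f ((V.d j i).hom ((V.d l j).hom x)) = 0
    rw [V.d_hom_d_hom, map_zero]

end CochainComplex

namespace CDGA

variable {k : Type u} [Field k]

section Dual

theorem lid_rTensor_eval (A : CDGA k) (p q : ℕ) (a : A.X.X p)
    (t : Module.Dual k (A.X.X p) ⊗[k] Module.Dual k (A.X.X q)) (b : A.X.X q) :
    TensorProduct.lid k (Module.Dual k (A.X.X q))
        ((Module.Dual.eval k (A.X.X p) a).rTensor _ t) b =
      TensorProduct.dualDistrib k (A.X.X p) (A.X.X q) t (a ⊗ₜ b) := by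
  induction t with
  | zero => simp
  | tmul x y => simp
  | add x y hx hy => simp only [map_add, LinearMap.add_apply, hx, hy]

theorem rid_lTensor_eval (A : CDGA k) (p q : ℕ) (b : A.X.X q)
    (t : Module.Dual k (A.X.X p) ⊗[k] Module.Dual k (A.X.X q)) (a : A.X.X p) :
    TensorProduct.rid k (Module.Dual k (A.X.X p))
        ((Module.Dual.eval k (A.X.X q) b).lTensor _ t) a =
      TensorProduct.dualDistrib k (A.X.X p) (A.X.X q) t (a ⊗ₜ b) := by
  induction t with
  | zero => simp
  | tmul x y => simp [_root_.mul_comm]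
  | add x y hx hy => simp only [map_add, LinearMap.add_apply, hx, hy]

variable (A : CDGA k) [∀ n, Module.Finite k (A.X.X n)]

/-- The comultiplication of the dual: the transpose of the multiplication followed by the inverse
of the isomorphism `Aₚ^∨ ⊗ A_q^∨ ≅ (Aₚ ⊗ A_q)^∨`, `(f ⊗ g) (a ⊗ b) = f a * g b`. -/
def dualComul (p q n : ℕ) (h : p + q = n) :
    Module.Dual k (A.X.X n) →ₗ[k] Module.Dual k (A.X.X p) ⊗[k] Module.Dual k (A.X.X q) :=
  (TensorProduct.dualDistribEquiv k (A.X.X p) (A.X.X q)).symm.toLinearMap ∘ₗ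
    (TensorProduct.lift (A.mul p q n h)).dualMap

theorem dualDistrib_dualComul (p q n : ℕ) (h : p + q = n) (f : Module.Dual k (A.X.X n))
    (a : A.X.X p) (b : A.X.X q) :
    TensorProduct.dualDistrib k (A.X.X p) (A.X.X q) (A.dualComul p q n h f) (a ⊗ₜ b) =
      f (A.mul p q n h a b) := by
  have : TensorProduct.dualDistribEquiv k (A.X.X p) (A.X.X q) (A.dualComul p q n h f) =
      (TensorProduct.lift (A.mul p q n h)).dualMap f := by
    simp only [dualComul, LinearMap.comp_apply, LinearEquiv.coe_coe, LinearEquiv.apply_symm_apply]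
  exact LinearMap.congr_fun this (a ⊗ₜ b)

theorem dualDistrib_ext {M N : Type u} [AddCommGroup M] [Module k M] [AddCommGroup N] [Module k N]
    [Module.Finite k M] [Module.Finite k N] {s t : Module.Dual k M ⊗[k] Module.Dual k N}
    (h : ∀ a b, TensorProduct.dualDistrib k M N s (a ⊗ₜ b) =
      TensorProduct.dualDistrib k M N t (a ⊗ₜ b)) : s = t :=
  (TensorProduct.dualDistribEquiv k M N).injective (TensorProduct.ext' h)


theorem dualDistrib_assoc {M N P : Type u} [AddCommGroup M] [Module k M] [AddCommGroup N]
    [Module k N] [AddCommGroup P] [Module k P] (s : Module.Dual k M ⊗[k] Module.Dual k N)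
    (g : Module.Dual k P) (a : M) (b : N) (c : P) :
    TensorProduct.dualDistrib k M (N ⊗[k] P)
        ((TensorProduct.dualDistrib k N P).lTensor (Module.Dual k M)
          (TensorProduct.assoc k _ _ _ (s ⊗ₜ[k] g))) (a ⊗ₜ (b ⊗ₜ c)) =
      TensorProduct.dualDistrib k M N s (a ⊗ₜ b) * g c := by
  induction s with
  | zero =>
    rw [TensorProduct.zero_tmul, LinearEquiv.map_zero, LinearMap.map_zero, LinearMap.map_zero,
      LinearMap.map_zero]
    simp
  | tmul x y => simp [_root_.mul_assoc]
  | add x y hx hy =>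
    rw [TensorProduct.add_tmul, LinearEquiv.map_add]
    simp only [map_add, LinearMap.add_apply, hx, hy, add_mul]

theorem dualDistrib_ext₃ {M N P : Type u} [AddCommGroup M] [Module k M] [AddCommGroup N]
    [Module k N] [AddCommGroup P] [Module k P] [Module.Finite k M] [Module.Finite k N]
    [Module.Finite k P]
    {s t : Module.Dual k M ⊗[k] (Module.Dual k N ⊗[k] Module.Dual k P)}
    (h : ∀ a b c,
      TensorProduct.dualDistrib k M (N ⊗[k] P)
        ((TensorProduct.dualDistrib k N P).lTensor (Module.Dual k M) s) (a ⊗ₜ (b ⊗ₜ c)) =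
      TensorProduct.dualDistrib k M (N ⊗[k] P)
        ((TensorProduct.dualDistrib k N P).lTensor (Module.Dual k M) t) (a ⊗ₜ (b ⊗ₜ c))) :
    s = t := by
  apply ((TensorProduct.dualDistribEquiv k N P).lTensor (Module.Dual k M)).injective
  apply (TensorProduct.dualDistribEquiv k M (N ⊗[k] P)).injective
  apply TensorProduct.ext_threefold'
  exact h

theorem dualDistrib_rTensor_dualComul (p q m r : ℕ) (h : p + q = m)
    (t : Module.Dual k (A.X.X m) ⊗[k] Module.Dual k (A.X.X r))
    (a : A.X.X p) (b : A.X.X q) (c : A.X.X r) :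
    TensorProduct.dualDistrib k (A.X.X p) (A.X.X q ⊗[k] A.X.X r)
        ((TensorProduct.dualDistrib k (A.X.X q) (A.X.X r)).lTensor (Module.Dual k (A.X.X p))
          (TensorProduct.assoc k _ _ _ ((A.dualComul p q m h).rTensor _ t))) (a ⊗ₜ (b ⊗ₜ c)) =
      TensorProduct.dualDistrib k (A.X.X m) (A.X.X r) t (A.mul p q m h a b ⊗ₜ c) := by
  induction t with
  | zero =>
    rw [LinearMap.map_zero, LinearEquiv.map_zero, LinearMap.map_zero, LinearMap.map_zero,
      LinearMap.map_zero]
    simp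
  | tmul x y =>
    rw [LinearMap.rTensor_tmul, dualDistrib_assoc, dualDistrib_dualComul]
    simp
  | add x y hx hy =>
    rw [LinearMap.map_add, LinearEquiv.map_add]
    simp only [map_add, LinearMap.add_apply, hx, hy]

theorem dualDistrib_lTensor_dualComul (p q r l : ℕ) (h : q + r = l)
    (t : Module.Dual k (A.X.X p) ⊗[k] Module.Dual k (A.X.X l))
    (a : A.X.X p) (b : A.X.X q) (c : A.X.X r) :
    TensorProduct.dualDistrib k (A.X.X p) (A.X.X q ⊗[k] A.X.X r)
        ((TensorProduct.dualDistrib k (A.X.X q) (A.X.X r)).lTensor (Module.Dual k (A.X.X p))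
          ((A.dualComul q r l h).lTensor _ t)) (a ⊗ₜ (b ⊗ₜ c)) =
      TensorProduct.dualDistrib k (A.X.X p) (A.X.X l) t (a ⊗ₜ A.mul q r l h b c) := by
  induction t with
  | zero => simp
  | tmul x y =>
    simp only [LinearMap.lTensor_tmul, TensorProduct.dualDistrib_apply, dualDistrib_dualComul]
  | add x y hx hy => simp only [map_add, LinearMap.add_apply, hx, hy]

theorem dualDistrib_comm {M N : Type u} [AddCommGroup M] [Module k M] [AddCommGroup N] [Module k N]
    (t : Module.Dual k M ⊗[k] Module.Dual k N) (a : M) (b : N) :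
    TensorProduct.dualDistrib k N M (TensorProduct.comm k _ _ t) (b ⊗ₜ a) =
      TensorProduct.dualDistrib k M N t (a ⊗ₜ b) := by
  induction t with
  | zero => simp
  | tmul x y => simp [_root_.mul_comm]
  | add x y hx hy => simp only [map_add, LinearMap.add_apply, hx, hy]

theorem dualDistrib_map_dualMap {M N M' N' : Type u} [AddCommGroup M] [Module k M]
    [AddCommGroup N] [Module k N] [AddCommGroup M'] [Module k M'] [AddCommGroup N'] [Module k N']
    (φ : M →ₗ[k] M') (ψ : N →ₗ[k] N')
    (t : Module.Dual k M' ⊗[k] Module.Dual k N') (a : M) (b : N) :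
    TensorProduct.dualDistrib k M N (TensorProduct.map φ.dualMap ψ.dualMap t) (a ⊗ₜ b) =
      TensorProduct.dualDistrib k M' N' t (φ a ⊗ₜ ψ b) := by
  induction t with
  | zero => simp
  | tmul x y => simp
  | add x y hx hy => simp only [map_add, LinearMap.add_apply, hx, hy]

/-- The dual of a commutative differential graded algebra that is finite-dimensional in each
degree, with the transposed structure maps: `(Δ f) (a ⊗ b) = f (a b)`, `ε f = f 1`,
`d f = f ∘ d`. -/
def dual : CDGC k where
  X := A.X.linearDual
  comul := A.dualComul
  counit := Module.Dual.eval k (A.X.X 0) A.one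
  coassoc p q r m l n h₁ h₂ h₃ h₄ f := by
    refine dualDistrib_ext₃ (fun a b c => ?_)
    refine (A.dualDistrib_rTensor_dualComul p q m r h₁ _ a b c).trans ?_
    refine Eq.trans ?_ (A.dualDistrib_lTensor_dualComul p q r l h₃ _ a b c).symm
    refine (A.dualDistrib_dualComul m r n h₂ f _ c).trans ?_
    refine Eq.trans ?_ (A.dualDistrib_dualComul p l n h₄ f a _).symm
    rw [A.mul_assoc p q r m l n h₁ h₂ h₃ h₄]
  counit_comul n f := by
    refine LinearMap.ext (fun b => ?_)
    refine (A.lid_rTensor_eval 0 n A.one _ b).trans ?_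
    refine (A.dualDistrib_dualComul 0 n n _ f _ b).trans ?_
    rw [A.one_mul]
  comul_counit n f := by
    refine LinearMap.ext (fun b => ?_)
    refine (A.rid_lTensor_eval n 0 A.one _ b).trans ?_
    refine (A.dualDistrib_dualComul n 0 n _ f b _).trans ?_
    rw [A.mul_one]
  cocomm p q n h h' (f : Module.Dual k (A.X.X n)) := by
    refine dualDistrib_ext (fun b a => ?_)
    refine (dualDistrib_comm (k := k) _ a b).trans ?_
    refine (A.dualDistrib_dualComul p q n h f a b).trans ?_
    refine Eq.trans ?_ (LinearMap.congr_fun (LinearMap.map_smul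
      (TensorProduct.dualDistrib k (A.X.X q) (A.X.X p)) _ (A.dualComul q p n h' f)) _).symm
    refine Eq.trans ?_ (congrArg (fun x => (-1 : k) ^ (p * q) • x)
      (A.dualDistrib_dualComul q p n h' f b a)).symm
    rw [A.mul_comm p q n h h', map_smul]
  comul_d p q n h h₁ h₂ (f : Module.Dual k (A.X.X (n + 1))) := by
    refine dualDistrib_ext (fun a b => ?_)
    refine (A.dualDistrib_dualComul p q n h _ a b).trans ?_
    refine Eq.trans ?_ (LinearMap.congr_fun ((LinearMap.map_add
      (TensorProduct.dualDistrib k (A.X.X p) (A.X.X q)) _ _).trans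
      (congrArg (_ + ·) (LinearMap.map_smul
        (TensorProduct.dualDistrib k (A.X.X p) (A.X.X q)) ((-1 : k) ^ p) _))) _).symm
    have e₁ := (dualDistrib_map_dualMap (A.X.d p (p + 1)).hom LinearMap.id
      (A.dualComul (p + 1) q (n + 1) h₁ f) a b).trans
      (A.dualDistrib_dualComul (p + 1) q (n + 1) h₁ f _ _)
    have e₂ := (dualDistrib_map_dualMap LinearMap.id (A.X.d q (q + 1)).hom
      (A.dualComul p (q + 1) (n + 1) h₂ f) a b).trans
      (A.dualDistrib_dualComul p (q + 1) (n + 1) h₂ f _ _)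
    refine Eq.trans ?_ (congrArg₂ (fun x y => x + (-1 : k) ^ p • y) e₁ e₂).symm
    change f ((A.X.d n (n + 1)).hom (A.mul p q n h a b)) = _
    rw [A.leibniz p q n h h₁ h₂, map_add, map_smul]
    rfl
  counit_d (f : Module.Dual k (A.X.X 1)) := by
    have h := A.leibniz 0 0 0 rfl rfl rfl A.one A.one
    rw [A.one_mul, A.mul_one, A.one_mul, pow_zero, one_smul, left_eq_add] at h
    change f ((A.X.d 0 1).hom A.one) = 0
    rw [h, map_zero]

end Dual

/-- The transpose of a morphism of algebras. -/
def dualMap {A B : CDGA k} [∀ n, Module.Finite k (A.X.X n)] [∀ n, Module.Finite k (B.X.X n)]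
    (φ : A ⟶ B) : B.dual ⟶ A.dual where
  f :=
    { f := fun n => ModuleCat.ofHom (φ.f.f n).hom.dualMap
      comm' := fun i j _ => by
        ext (g : Module.Dual k (B.X.X i))
        refine LinearMap.ext (fun a => ?_)
        change g ((φ.f.f i).hom ((A.X.d j i).hom a)) = g ((B.X.d j i).hom ((φ.f.f j).hom a))
        rw [← ModuleCat.comp_apply, ← ModuleCat.comp_apply, φ.f.comm] }
  map_comul p q n h (g : Module.Dual k (B.X.X n)) := by
    refine dualDistrib_ext (fun a b => ?_)
    refine (A.dualDistrib_dualComul p q n h _ a b).trans ?_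
    refine Eq.trans ?_ (dualDistrib_map_dualMap (φ.f.f p).hom (φ.f.f q).hom
      (B.dualComul p q n h g) a b).symm
    refine Eq.trans ?_ (B.dualDistrib_dualComul p q n h g _ _).symm
    change g ((φ.f.f n).hom (A.mul p q n h a b)) = _
    rw [φ.map_mul]
  map_counit (g : Module.Dual k (B.X.X 0)) := by
    change g ((φ.f.f 0).hom A.one) = g B.one
    rw [φ.map_one]

/-! ### Differential ideals of finite codimension -/

/-- A differential (graded) ideal of finite codimension in a commutative differential graded
algebra. By graded commutativity a one-sided ideal is two-sided. -/
@[ext]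
structure CofiniteIdeal (A : CDGA k) where
  I (n : ℕ) : Submodule k (A.X.X n)
  mul_mem : ∀ (p q n : ℕ) (h : p + q = n) (a : A.X.X p), ∀ b ∈ I q, A.mul p q n h a b ∈ I n
  d_mem : ∀ (i j : ℕ), ∀ a ∈ I i, (A.X.d i j).hom a ∈ I j
  finite : IsTotallyFinite k (fun n => A.X.X n ⧸ I n)

namespace CofiniteIdeal

variable {A : CDGA k}

/-- Inclusion of ideals. -/
instance : PartialOrder (CofiniteIdeal A) :=
  PartialOrder.lift (fun J => J.I) (fun _ _ h => CofiniteIdeal.ext h)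

theorem mul_mem' (J : CofiniteIdeal A) (p q n : ℕ) (h : p + q = n) (a : A.X.X p) (ha : a ∈ J.I p)
    (b : A.X.X q) : A.mul p q n h a b ∈ J.I n := by
  rw [A.mul_comm p q n h (by omega)]
  exact (J.I n).smul_mem _ (J.mul_mem q p n _ b a ha)

/-- The multiplication of the quotient algebra. -/
def quotientMul (J : CofiniteIdeal A) (p q n : ℕ) (h : p + q = n) :
    (A.X.X p ⧸ J.I p) →ₗ[k] (A.X.X q ⧸ J.I q) →ₗ[k] (A.X.X n ⧸ J.I n) :=
  (J.I p).liftQ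
    { toFun := fun a => (J.I q).mapQ (J.I n) (A.mul p q n h a)
        (fun b hb => J.mul_mem p q n h a b hb)
      map_add' := fun a a' => by
        ext b
        simp
      map_smul' := fun c a => by
        ext b
        simp }
    (fun a ha => by
      refine LinearMap.mem_ker.mpr (Submodule.linearMap_qext _ (LinearMap.ext fun b => ?_))
      exact (Submodule.Quotient.mk_eq_zero _).mpr (J.mul_mem' p q n h a ha b))

/-- The quotient algebra `A / I`. -/
def quotient (J : CofiniteIdeal A) : CDGA k where
  X :=
    { X := fun n => ModuleCat.of k (A.X.X n ⧸ J.I n)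
      d := fun i j => ModuleCat.ofHom ((J.I i).mapQ (J.I j) (A.X.d i j).hom (J.d_mem i j))
      shape := fun i j h => by
        ext a
        change Submodule.Quotient.mk ((A.X.d i j).hom a) = 0
        rw [A.X.shape i j h]
        rfl
      d_comp_d' := fun i j l _ _ => by
        ext a
        change Submodule.Quotient.mk ((A.X.d j l).hom ((A.X.d i j).hom a)) = 0
        rw [A.X.d_hom_d_hom]
        rfl }
  mul := J.quotientMul
  one := Submodule.Quotient.mk A.one
  mul_assoc p q r m l n h₁ h₂ h₃ h₄ a b c := by
    induction a using Submodule.Quotient.induction_on with | _ a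
    induction b using Submodule.Quotient.induction_on with | _ b
    induction c using Submodule.Quotient.induction_on with | _ c
    exact congrArg Submodule.Quotient.mk (A.mul_assoc p q r m l n h₁ h₂ h₃ h₄ a b c)
  one_mul n a := by
    induction a using Submodule.Quotient.induction_on with | _ a
    exact congrArg Submodule.Quotient.mk (A.one_mul n a)
  mul_one n a := by
    induction a using Submodule.Quotient.induction_on with | _ a
    exact congrArg Submodule.Quotient.mk (A.mul_one n a)
  mul_comm p q n h h' a b := by
    induction a using Submodule.Quotient.induction_on with | _ a
    induction b using Submodule.Quotient.induction_on with | _ b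
    exact congrArg Submodule.Quotient.mk (A.mul_comm p q n h h' a b)
  leibniz p q n h h₁ h₂ a b := by
    induction a using Submodule.Quotient.induction_on with | _ a
    induction b using Submodule.Quotient.induction_on with | _ b
    exact congrArg Submodule.Quotient.mk (A.leibniz p q n h h₁ h₂ a b)

theorem isFiniteDim_quotient (J : CofiniteIdeal A) : J.quotient.X.IsFiniteDim :=
  J.finite

instance (J : CofiniteIdeal A) (n : ℕ) : Module.Finite k (J.quotient.X.X n) :=
  J.isFiniteDim_quotient.finite n

/-- The quotient map `A / I ⟶ A / J` for `I ≤ J`. -/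
def factor {I J : CofiniteIdeal A} (h : I ≤ J) : I.quotient ⟶ J.quotient where
  f :=
    { f := fun n => ModuleCat.ofHom (Submodule.factor (h n))
      comm' := fun i j _ => by
        ext a
        induction a using Submodule.Quotient.induction_on with | _ a
        rfl }
  map_mul p q n _ a b := by
    induction a using Submodule.Quotient.induction_on with | _ a
    induction b using Submodule.Quotient.induction_on with | _ b
    rfl
  map_one := rfl

end CofiniteIdeal

/-- The diagram of coalgebras `I ↦ (A / I)^∨`, for `I` running over the differential ideals of
finite codimension, with the transposes of the quotient maps `A / I ⟶ A / J`, `I ≤ J`. It is the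
dual of the profinite completion `{A / I}` of `A`. -/
def dualQuotients (A : CDGA k) : (CofiniteIdeal A)ᵒᵖ ⥤ CDGC k where
  obj J := J.unop.quotient.dual
  map f := dualMap (CofiniteIdeal.factor (leOfHom f.unop))
  map_id J := by
    refine CDGC.Hom.ext (HomologicalComplex.hom_ext _ _ fun n => ?_)
    ext g
    refine LinearMap.ext (fun a => ?_)
    induction a using Submodule.Quotient.induction_on with | _ a
    rfl
  map_comp f g := by
    refine CDGC.Hom.ext (HomologicalComplex.hom_ext _ _ fun n => ?_)
    ext g
    refine LinearMap.ext (fun a => ?_)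
    induction a using Submodule.Quotient.induction_on with | _ a
    rfl

end CDGA

/-! ### The free graded commutative algebra -/

namespace FreeCDGA

variable {k : Type u} [Field k] (W : CochainComplex (ModuleCat.{u} k) ℕ)

/-- A generator `x ∈ Wₙ` as an element of the tensor algebra of the total space of `W`. -/
def tgen (n : ℕ) : W.X n →ₗ[k] TensorAlgebra k (⨁ i, W.X i) :=
  TensorAlgebra.ι k ∘ₗ DirectSum.lof k ℕ (fun i => W.X i) n

/-- The relations `x y = (-1)^{pq} y x` between generators `x ∈ Wₚ`, `y ∈ W_q`. -/
inductive Rel : TensorAlgebra k (⨁ i, W.X i) → TensorAlgebra k (⨁ i, W.X i) → Prop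
  | comm (p q : ℕ) (x : W.X p) (y : W.X q) :
      Rel (tgen W p x * tgen W q y) ((-1 : k) ^ (p * q) • (tgen W q y * tgen W p x))

/-- The underlying algebra of `Λ W`: the tensor algebra modulo graded commutativity. -/
def Alg : Type u := RingQuot (Rel W)

instance : Ring (Alg W) := inferInstanceAs (Ring (RingQuot (Rel W)))

instance : Algebra k (Alg W) := inferInstanceAs (Algebra k (RingQuot (Rel W)))

/-- The quotient map from the tensor algebra to `Λ W`. -/
def mk : TensorAlgebra k (⨁ i, W.X i) →ₐ[k] Alg W := RingQuot.mkAlgHom k (Rel W)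

theorem mk_surjective : Function.Surjective (mk W) := RingQuot.mkAlgHom_surjective k (Rel W)

/-- A generator `x ∈ Wₙ` as an element of `Λ W`. -/
def gen (n : ℕ) : W.X n →ₗ[k] Alg W :=
  (mk W).toLinearMap ∘ₗ tgen W n

theorem gen_mul_gen (p q : ℕ) (x : W.X p) (y : W.X q) :
    gen W p x * gen W q y = (-1 : k) ^ (p * q) • (gen W q y * gen W p x) := by
  have h : mk W _ = mk W _ := RingQuot.mkAlgHom_rel k (Rel.comm (W := W) p q x y)
  rw [map_mul, map_smul, map_mul] at h
  exact h

/-- The matrix `!![(-1)^n x, d x; 0, x]` attached to a generator `x ∈ Wₙ`. -/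
def genMatrix (n : ℕ) : W.X n →ₗ[k] Matrix (Fin 2) (Fin 2) (Alg W) where
  toFun x := !![(-1 : k) ^ n • gen W n x, gen W (n + 1) ((W.d n (n + 1)).hom x); 0, gen W n x]
  map_add' x y := by
    ext i j
    fin_cases i <;> fin_cases j <;> simp
  map_smul' c x := by
    ext i j
    fin_cases i <;> fin_cases j <;> simp [smul_comm c]

theorem genMatrix_mul (p q : ℕ) (x : W.X p) (y : W.X q) :
    genMatrix W p x * genMatrix W q y =
      (-1 : k) ^ (p * q) • (genMatrix W q y * genMatrix W p x) := by
  have hp : (-1 : k) ^ p * (-1 : k) ^ p = 1 := by rw [← mul_pow]; simp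
  have h := gen_mul_gen W p q x y
  have h₁ := gen_mul_gen W p (q + 1) x ((W.d q (q + 1)).hom y)
  have h₂ := gen_mul_gen W (p + 1) q ((W.d p (p + 1)).hom x) y
  ext i j
  fin_cases i <;> fin_cases j
  · simp [genMatrix, Matrix.mul_apply, h, smul_smul]
    congr 1
    ring
  · simp [genMatrix, Matrix.mul_apply, h₁, h₂, smul_smul]
    rw [add_comm]
    congr 2
    · ring
    · rw [mul_add, pow_add, mul_one, mul_left_comm, hp, mul_one]
  · simp [genMatrix, Matrix.mul_apply]
  · simp [genMatrix, Matrix.mul_apply, h]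

/-- The algebra homomorphism `a ↦ !![σ a, d a; 0, a]`, where `σ` is multiplication by `(-1)^n` in
degree `n` and `d` is the differential of `Λ W`. That this map is multiplicative means that
`d (a b) = d a * b + σ a * d b`. -/
def dMatrix : Alg W →ₐ[k] Matrix (Fin 2) (Fin 2) (Alg W) :=
  RingQuot.liftAlgHom k ⟨TensorAlgebra.lift k (DirectSum.toModule k ℕ _ (genMatrix W)), by
    rintro _ _ ⟨p, q, x, y⟩
    simpa [tgen] using genMatrix_mul W p q x y⟩

theorem dMatrix_gen (n : ℕ) (x : W.X n) : dMatrix W (gen W n x) = genMatrix W n x := by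
  have h : dMatrix W (mk W (tgen W n x)) =
      TensorAlgebra.lift k (DirectSum.toModule k ℕ _ (genMatrix W)) (tgen W n x) :=
    RingQuot.liftAlgHom_mkAlgHom_apply _ _ _ _
  refine h.trans ?_
  simp [tgen]

/-- The differential of `Λ W`: the graded derivation extending the differential of `W`. -/
def diff : Alg W →ₗ[k] Alg W where
  toFun a := dMatrix W a 0 1
  map_add' a b := by simp
  map_smul' c a := by simp

/-- The homogeneous words: `IsWord n a` means that `a` is a product of generators of total
degree `n`. -/
inductive IsWord : ℕ → Alg W → Prop
  | one : IsWord 0 1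
  | cons (p q n : ℕ) (h : p + q = n) (x : W.X p) (a : Alg W) :
      IsWord q a → IsWord n (gen W p x * a)

/-- The homogeneous part of degree `n` of `Λ W`. -/
def deg (n : ℕ) : Submodule k (Alg W) := Submodule.span k {a | IsWord W n a}

variable {W}

theorem IsWord.mul {p q n : ℕ} (h : p + q = n) {a b : Alg W} (ha : IsWord W p a)
    (hb : IsWord W q b) : IsWord W n (a * b) := by
  induction ha generalizing n with
  | one =>
    rw [one_mul]
    obtain rfl : q = n := by omega
    exact hb
  | cons p' q' m h' x a _ ih =>
    rw [_root_.mul_assoc]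
    exact IsWord.cons p' (q' + q) n (by omega) x _ (ih rfl)

theorem mul_mem_deg {p q n : ℕ} (h : p + q = n) {a b : Alg W} (ha : a ∈ deg W p)
    (hb : b ∈ deg W q) : a * b ∈ deg W n := by
  have : a * b ∈ deg W p * deg W q := Submodule.mul_mem_mul ha hb
  rw [deg, deg, Submodule.span_mul_span] at this
  refine Submodule.span_mono ?_ this
  rintro _ ⟨a, ha, b, hb, rfl⟩
  exact IsWord.mul h ha hb

theorem gen_mem_deg (n : ℕ) (x : W.X n) : gen W n x ∈ deg W n :=
  Submodule.subset_span (by simpa using IsWord.cons n 0 n rfl x 1 IsWord.one)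

theorem one_mem_deg : (1 : Alg W) ∈ deg W 0 := Submodule.subset_span IsWord.one

theorem IsWord.comm {p q : ℕ} {a b : Alg W} (ha : IsWord W p a) (hb : IsWord W q b) :
    a * b = (-1 : k) ^ (p * q) • (b * a) := by
  have key : ∀ (m : ℕ) (x : W.X m) {q : ℕ} {b : Alg W}, IsWord W q b →
      gen W m x * b = (-1 : k) ^ (m * q) • (b * gen W m x) := by
    intro m x q b hb
    induction hb with
    | one => simp
    | cons p' q' n h y b _ ih =>
      subst h
      rw [← _root_.mul_assoc, gen_mul_gen, smul_mul_assoc, _root_.mul_assoc, ih, mul_smul_comm,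
        smul_smul, ← pow_add, ← mul_add, _root_.mul_assoc]
  induction ha with
  | one => simp
  | cons p' q' n h x a _ ih =>
    subst h
    rw [_root_.mul_assoc, ih, mul_smul_comm, ← _root_.mul_assoc, key p' x hb, smul_mul_assoc,
      smul_smul, ← pow_add, _root_.mul_assoc]
    congr 2
    ring

theorem deg_comm {p q : ℕ} {a b : Alg W} (ha : a ∈ deg W p) (hb : b ∈ deg W q) :
    a * b = (-1 : k) ^ (p * q) • (b * a) := by
  induction ha using Submodule.span_induction with
  | zero => simp
  | add x y _ _ hx hy => rw [add_mul, hx, hy, mul_add, smul_add]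
  | smul c x _ hx => rw [smul_mul_assoc, hx, mul_smul_comm, smul_comm]
  | mem a ha =>
    induction hb using Submodule.span_induction with
    | zero => simp
    | add x y _ _ hx hy => rw [mul_add, hx, hy, add_mul, smul_add]
    | smul c x _ hx => rw [mul_smul_comm, hx, smul_mul_assoc, smul_comm]
    | mem b hb => exact IsWord.comm ha hb

theorem dMatrix_one_one (a : Alg W) : dMatrix W a 1 1 = a ∧ dMatrix W a 1 0 = 0 := by
  obtain ⟨t, rfl⟩ := mk_surjective W a
  induction t using TensorAlgebra.induction with
  | algebraMap c => simp [Matrix.algebraMap_matrix_apply]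
  | ι x =>
    induction x using DirectSum.induction_on with
    | zero => simp
    | of n x =>
      have h := dMatrix_gen W n x
      change dMatrix W (gen W n x) 1 1 = gen W n x ∧ dMatrix W (gen W n x) 1 0 = 0
      rw [h]
      simp [genMatrix]
    | add x y hx hy =>
      rw [map_add, map_add, map_add, Matrix.add_apply, Matrix.add_apply, hx.1, hx.2, hy.1, hy.2]
      simp
  | mul x y hx hy =>
    rw [map_mul, map_mul, Matrix.mul_apply, Matrix.mul_apply, Fin.sum_univ_two, Fin.sum_univ_two,
      hx.1, hx.2, hy.1, hy.2]
    simp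
  | add x y hx hy =>
    rw [map_add, map_add, Matrix.add_apply, Matrix.add_apply, hx.1, hx.2, hy.1, hy.2]
    simp

theorem dMatrix_zero_zero {n : ℕ} {a : Alg W} (ha : a ∈ deg W n) :
    dMatrix W a 0 0 = (-1 : k) ^ n • a := by
  induction ha using Submodule.span_induction with
  | zero => simp
  | add x y _ _ hx hy => rw [map_add, Matrix.add_apply, hx, hy, smul_add]
  | smul c x _ hx => rw [map_smul, Matrix.smul_apply, hx, smul_comm]
  | mem a ha =>
    have ha' : IsWord W n a := ha
    clear ha
    induction ha' with
    | one => simp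
    | cons p q n h x a _ ih =>
      subst h
      rw [map_mul, Matrix.mul_apply, Fin.sum_univ_two, (dMatrix_one_one a).2, ih, dMatrix_gen]
      simp [genMatrix, smul_smul, pow_add, _root_.mul_comm]

theorem diff_gen (n : ℕ) (x : W.X n) :
    diff W (gen W n x) = gen W (n + 1) ((W.d n (n + 1)).hom x) := by
  change dMatrix W (gen W n x) 0 1 = _
  rw [dMatrix_gen]
  simp [genMatrix]

theorem diff_mul {n : ℕ} {a : Alg W} (ha : a ∈ deg W n) (b : Alg W) :
    diff W (a * b) = diff W a * b + (-1 : k) ^ n • (a * diff W b) := by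
  change dMatrix W (a * b) 0 1 = dMatrix W a 0 1 * b + (-1 : k) ^ n • (a * dMatrix W b 0 1)
  rw [map_mul, Matrix.mul_apply, Fin.sum_univ_two, dMatrix_zero_zero ha, (dMatrix_one_one b).1,
    smul_mul_assoc, add_comm]

theorem diff_one : diff W (1 : Alg W) = 0 := by
  change dMatrix W 1 0 1 = 0
  simp

theorem diff_mem_deg {n : ℕ} {a : Alg W} (ha : a ∈ deg W n) : diff W a ∈ deg W (n + 1) := by
  induction ha using Submodule.span_induction with
  | zero => simp
  | add x y _ _ hx hy => rw [map_add]; exact add_mem hx hy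
  | smul c x _ hx => rw [map_smul]; exact Submodule.smul_mem _ c hx
  | mem a ha =>
    have ha' : IsWord W n a := ha
    clear ha
    induction ha' with
    | one => rw [diff_one]; exact zero_mem _
    | cons p q n h x a ha ih =>
      rw [diff_mul (gen_mem_deg p x), diff_gen]
      exact add_mem (mul_mem_deg (by omega) (gen_mem_deg _ _) (Submodule.subset_span ha))
        (Submodule.smul_mem _ _ (mul_mem_deg (by omega) (gen_mem_deg _ _) ih))

theorem diff_diff {n : ℕ} {a : Alg W} (ha : a ∈ deg W n) : diff W (diff W a) = 0 := by
  induction ha using Submodule.span_induction with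
  | zero => simp
  | add x y _ _ hx hy => rw [map_add, map_add, hx, hy, add_zero]
  | smul c x _ hx => rw [map_smul, map_smul, hx, smul_zero]
  | mem a ha =>
    have ha' : IsWord W n a := ha
    clear ha
    induction ha' with
    | one => rw [diff_one, map_zero]
    | cons p q n h x a ha ih =>
      rw [diff_mul (gen_mem_deg p x), diff_gen, map_add, map_smul, diff_mul (gen_mem_deg _ _),
        diff_mul (gen_mem_deg _ _), diff_gen, diff_gen, W.d_hom_d_hom, ih, map_zero]
      simp [pow_succ, neg_smul]

end FreeCDGA

/-- The multiplication of `Λ W` on homogeneous parts. -/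
def freeMul {k : Type u} [Field k] (W : CochainComplex (ModuleCat.{u} k) ℕ) (p q n : ℕ)
    (h : p + q = n) :
    FreeCDGA.deg W p →ₗ[k] FreeCDGA.deg W q →ₗ[k] FreeCDGA.deg W n :=
  LinearMap.mk₂ k
    (fun a b => (⟨a.1 * b.1, FreeCDGA.mul_mem_deg h a.2 b.2⟩ : FreeCDGA.deg W n))
    (fun _ _ _ => Subtype.ext (add_mul _ _ _))
    (fun _ _ _ => Subtype.ext (smul_mul_assoc _ _ _))
    (fun _ _ _ => Subtype.ext (mul_add _ _ _))
    (fun _ _ _ => Subtype.ext (mul_smul_comm _ _ _))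

theorem freeMul_assoc {k : Type u} [Field k] (W : CochainComplex (ModuleCat.{u} k) ℕ)
    (p q r m l n : ℕ) (h₁ : p + q = m) (h₂ : m + r = n) (h₃ : q + r = l) (h₄ : p + l = n)
    (a : FreeCDGA.deg W p) (b : FreeCDGA.deg W q) (c : FreeCDGA.deg W r) :
    freeMul W m r n h₂ (freeMul W p q m h₁ a b) c =
      freeMul W p l n h₄ a (freeMul W q r l h₃ b c) :=
  Subtype.ext (mul_assoc a.1 b.1 c.1)

theorem freeMul_one_left {k : Type u} [Field k] (W : CochainComplex (ModuleCat.{u} k) ℕ)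
    (n : ℕ) (a : FreeCDGA.deg W n) :
    freeMul W 0 n n (Nat.zero_add n) ⟨1, FreeCDGA.one_mem_deg⟩ a = a :=
  Subtype.ext (one_mul a.1)

theorem freeMul_one_right {k : Type u} [Field k] (W : CochainComplex (ModuleCat.{u} k) ℕ)
    (n : ℕ) (a : FreeCDGA.deg W n) :
    freeMul W n 0 n (Nat.add_zero n) a ⟨1, FreeCDGA.one_mem_deg⟩ = a :=
  Subtype.ext (mul_one a.1)

theorem freeMul_comm {k : Type u} [Field k] (W : CochainComplex (ModuleCat.{u} k) ℕ)
    (p q n : ℕ) (h : p + q = n) (h' : q + p = n) (a : FreeCDGA.deg W p) (b : FreeCDGA.deg W q) :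
    freeMul W p q n h a b = (-1 : k) ^ (p * q) • freeMul W q p n h' b a :=
  Subtype.ext (FreeCDGA.deg_comm a.2 b.2)

/-- The differential of `Λ W` on homogeneous parts. -/
def freeDiff {k : Type u} [Field k] (W : CochainComplex (ModuleCat.{u} k) ℕ) (n : ℕ) :
    FreeCDGA.deg W n →ₗ[k] FreeCDGA.deg W (n + 1) :=
  (FreeCDGA.diff W).restrict fun _ h => FreeCDGA.diff_mem_deg h

/-- The underlying complex of `Λ W`. -/
def freeComplex {k : Type u} [Field k] (W : CochainComplex (ModuleCat.{u} k) ℕ) :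
    CochainComplex (ModuleCat.{u} k) ℕ :=
  CochainComplex.of (fun n => ModuleCat.of k (FreeCDGA.deg W n))
    (fun n => ModuleCat.ofHom (freeDiff W n))
    (fun n => ModuleCat.hom_ext (LinearMap.ext fun a => Subtype.ext
      (p := fun x => x ∈ FreeCDGA.deg W (n + 1 + 1)) (FreeCDGA.diff_diff a.2)))

theorem freeComplex_d {k : Type u} [Field k] (W : CochainComplex (ModuleCat.{u} k) ℕ) (n : ℕ) :
    (freeComplex W).d n (n + 1) = ModuleCat.ofHom (freeDiff W n) :=
  CochainComplex.of_d (fun n => ModuleCat.of k (FreeCDGA.deg W n))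
    (fun n => ModuleCat.ofHom (freeDiff W n)) n

theorem freeDiff_mul {k : Type u} [Field k] (W : CochainComplex (ModuleCat.{u} k) ℕ)
    (p q n : ℕ) (h : p + q = n) (h₁ : (p + 1) + q = n + 1) (h₂ : p + (q + 1) = n + 1)
    (a : FreeCDGA.deg W p) (b : FreeCDGA.deg W q) :
    freeDiff W n (freeMul W p q n h a b) =
      freeMul W (p + 1) q (n + 1) h₁ (freeDiff W p a) b +
        (-1 : k) ^ p • freeMul W p (q + 1) (n + 1) h₂ a (freeDiff W q b) :=
  Subtype.ext (FreeCDGA.diff_mul a.2 b.1)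

theorem freeMul_leibniz {k : Type u} [Field k] (W : CochainComplex (ModuleCat.{u} k) ℕ)
    (p q n : ℕ) (h : p + q = n) (h₁ : (p + 1) + q = n + 1) (h₂ : p + (q + 1) = n + 1)
    (a : FreeCDGA.deg W p) (b : FreeCDGA.deg W q) :
    ((freeComplex W).d n (n + 1)).hom (freeMul W p q n h a b) =
      freeMul W (p + 1) q (n + 1) h₁ (((freeComplex W).d p (p + 1)).hom a) b +
        (-1 : k) ^ p •
          freeMul W p (q + 1) (n + 1) h₂ a (((freeComplex W).d q (q + 1)).hom b) := by
  rw [freeComplex_d, freeComplex_d, freeComplex_d]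
  exact freeDiff_mul W p q n h h₁ h₂ a b

/-- The free graded commutative differential algebra `Λ W` on a non-positively graded complex. -/
def freeCDGA {k : Type u} [Field k] (W : CochainComplex (ModuleCat.{u} k) ℕ) : CDGA k where
  X := freeComplex W
  mul := freeMul W
  one := (⟨1, FreeCDGA.one_mem_deg⟩ : FreeCDGA.deg W 0)
  mul_assoc := freeMul_assoc W
  one_mul := freeMul_one_left W
  mul_one := freeMul_one_right W
  mul_comm := freeMul_comm W
  leibniz := freeMul_leibniz W

/-- The inclusion of generators `W ⟶ Λ W`. -/
def freeCDGAUnit {k : Type u} [Field k] (W : CochainComplex (ModuleCat.{u} k) ℕ) :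
    W ⟶ (freeCDGA W).X where
  f n := ModuleCat.ofHom ((FreeCDGA.gen W n).codRestrict _ (FreeCDGA.gen_mem_deg n))
  comm' := by
    rintro i _ rfl
    refine ModuleCat.hom_ext (LinearMap.ext fun x => ?_)
    change ((freeComplex W).d i (i + 1)).hom _ = _
    rw [freeComplex_d]
    exact Subtype.ext (p := fun x => x ∈ FreeCDGA.deg W (i + 1)) (FreeCDGA.diff_gen i x)

/-! ### The canonical maps -/

section Canonical

variable {k : Type u} [Field k] (V : ChainComplex (ModuleCat.{u} k) ℕ)

/-- For `V` finite-dimensional and a differential ideal `I` of `Λ V^∨` of finite codimension, the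
chain map `(Λ V^∨ / I)^∨ ⟶ V^∨^∨ ≅ V`, transpose of the composite `V^∨ ⟶ Λ V^∨ ⟶ Λ V^∨ / I`: it
sends `f` to the unique `v` with `f [g] = g v` for all `g` in `V^∨`. -/
def dualQuotientToComplex (hV : V.IsFiniteDim) (J : CDGA.CofiniteIdeal (freeCDGA V.linearDual)) :
    J.quotient.dual.X ⟶ V :=
  haveI := fun n => hV.finite n
  { f := fun n => ModuleCat.ofHom
      ((Module.evalEquiv k (V.X n)).symm.toLinearMap ∘ₗ
        ((J.I n).mkQ ∘ₗ ((freeCDGAUnit V.linearDual).f n).hom).dualMap)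
    comm' := fun i j _ => by
      refine ModuleCat.hom_ext (LinearMap.ext fun (φ : Module.Dual k _) => ?_)
      apply (Module.evalEquiv k (V.X j)).injective
      refine LinearMap.ext fun g => ?_
      have hη := congrArg (fun t => ModuleCat.Hom.hom t g) ((freeCDGAUnit V.linearDual).comm j i)
      change ((freeCDGA V.linearDual).X.d j i).hom (((freeCDGAUnit V.linearDual).f j).hom g) =
        ((freeCDGAUnit V.linearDual).f i).hom (g ∘ₗ (V.d i j).hom) at hη
      change (g ∘ₗ (V.d i j).hom) ((Module.evalEquiv k (V.X i)).symm (φ ∘ₗ _)) =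
        g ((Module.evalEquiv k (V.X j)).symm _)
      rw [Module.apply_evalEquiv_symm_apply, Module.apply_evalEquiv_symm_apply]
      exact congrArg (fun t => φ (Submodule.Quotient.mk t)) hη.symm }

/-- The cocone of coalgebra maps `(Λ V^∨ / I)^∨ ⟶ C V` adjoint to the canonical chain maps
`(Λ V^∨ / I)^∨ ⟶ V`, for a right adjoint `C` of the forgetful functor. -/
def dualQuotientsCocone {C : ChainComplex (ModuleCat.{u} k) ℕ ⥤ CDGC k}
    (adj : CDGC.forget k ⊣ C) (hV : V.IsFiniteDim) :
    Cocone (CDGA.dualQuotients (freeCDGA V.linearDual)) where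
  pt := C.obj V
  ι :=
    { app := fun J => adj.homEquiv _ _ (dualQuotientToComplex V hV J.unop)
      naturality := fun J J' f => by
        refine (adj.homEquiv_naturality_left _ _).symm.trans ?_
        rfl }

/-- A finite-dimensional subcomplex of `V`. -/
@[ext]
structure FiniteSubcomplex where
  S (n : ℕ) : Submodule k (V.X n)
  d_mem : ∀ (i j : ℕ), ∀ x ∈ S i, (V.d i j).hom x ∈ S j
  finite : IsTotallyFinite k (fun n => S n)

namespace FiniteSubcomplex

/-- Inclusion of subcomplexes. -/
instance : PartialOrder (FiniteSubcomplex V) :=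
  PartialOrder.lift (fun S => S.S) (fun _ _ h => FiniteSubcomplex.ext h)

/-- The diagram of the finite-dimensional subcomplexes of `V` and their inclusions. -/
def diagram : FiniteSubcomplex V ⥤ ChainComplex (ModuleCat.{u} k) ℕ where
  obj S :=
    { X := fun n => ModuleCat.of k (S.S n)
      d := fun i j => ModuleCat.ofHom ((V.d i j).hom.restrict (S.d_mem i j))
      shape := fun i j h => by
        refine ModuleCat.hom_ext (LinearMap.ext fun x => Subtype.ext (p := (· ∈ S.S j)) ?_)
        change (V.d i j).hom x.1 = 0
        rw [V.shape i j h]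
        rfl
      d_comp_d' := fun i j l _ _ => by
        exact ModuleCat.hom_ext (LinearMap.ext fun x => Subtype.ext (p := (· ∈ S.S l))
          (V.d_hom_d_hom i j l x.1)) }
  map f :=
    { f := fun n => ModuleCat.ofHom (Submodule.inclusion (leOfHom f n))
      comm' := fun _ _ _ => rfl }
  map_id _ := rfl
  map_comp _ _ := rfl

/-- The inclusions of the finite-dimensional subcomplexes in `V`. -/
def cocone : Cocone (diagram V) where
  pt := V
  ι :=
    { app := fun S =>
        { f := fun n => ModuleCat.ofHom (S.S n).subtype
          comm' := fun _ _ _ => rfl }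
      naturality := fun _ _ _ => rfl }

end FiniteSubcomplex

end Canonical

/-! ### Totally finite graded vector spaces -/

/-! The right adjoint exists as soon as every complex V carries a cofree coalgebra, that is, a
terminal object among the coalgebras equipped with a chain map to V. The forgetful functor creates
colimits, so the natural candidate is a colimit of coalgebras that already map to V; the work lies
in checking that it is cofree.

The reduction to finite dimension is the fundamental theorem of coalgebras: every element x lies in
a finite-dimensional differential graded subcoalgebra, spanned by the slices (id ⊗ f)(Δ x) and their
boundaries (`FiniteSubcoalgebra.generated`). Hence a coalgebra map amounts to a compatible family of
maps on finite-dimensional subcoalgebras (`FiniteSubcoalgebra.glue`). This yields the criterion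
`isCofree_of_isColimit`: a colimit over V is cofree if chain maps D → V from finite-dimensional
coalgebras D lift to some term, uniquely once pushed into the colimit. No compactness of D enters:
gluing the lifts gives an endomorphism of the colimit, this turns out to be the identity, and
uniqueness follows. In the other direction, `nonempty_isColimit_of_isCofree` recognises a cocone
with cofree apex as a colimit by comparing it with the actual colimit, which is cofree too.

For V of finite total dimension, a chain map D → V transposes to V^∨ → D^∨ and extends to an algebra
map Λ V^∨ → D^∨. Its kernel I has finite codimension, and dualising Λ V^∨ / I → D^∨ gives the lift D
→ (Λ V^∨ / I)^∨ (`toDualQuotient`). Two lifts, for ideals I and J, correspond to algebra maps that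
agree on generators, hence everywhere, so the lifts coincide in (Λ V^∨ / (I ∩ J))^∨
(`evalQuotient_free_eq`, `comp_dualQuotients_map_eq`).

For arbitrary V, a map from a finite-dimensional D has its image in a finite-dimensional subcomplex,
on which a cofree coalgebra is already known; two lifts are compared over the sum of their
subcomplexes. So every V has a cofree coalgebra and the adjoint exists. Running the recognition
criterion on the counit of the adjunction then gives both colimit formulas. -/

theorem isTotallyFinite_iff {k : Type u} [Field k] {M : ℕ → Type u} [∀ n, AddCommGroup (M n)]
    [∀ n, Module k (M n)] :
    IsTotallyFinite k M ↔
      (∀ n, Module.Finite k (M n)) ∧ ∃ N, ∀ n, N ≤ n → Subsingleton (M n) := by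
  classical
  constructor
  · intro h
    refine ⟨h.finite, ?_⟩
    obtain ⟨s, hs⟩ := (h : Module.Finite k (⨁ n, M n)).fg_top
    -- The bound is one more than the largest degree occurring in the support of any of the finitely
    -- many generators.
    refine ⟨s.sup (fun x => (DFinsupp.support x).sup id) + 1, fun n hn => ?_⟩
    have key : ∀ x : ⨁ n, M n, DirectSum.component k ℕ M n x = 0 := by
      intro x
      have hx : x ∈ Submodule.span k (s : Set (⨁ n, M n)) := hs ▸ Submodule.mem_top
      induction hx using Submodule.span_induction with
      | zero => simp
      | add x y _ _ hx hy => rw [map_add, hx, hy, add_zero]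
      | smul c x _ hx => rw [map_smul, hx, smul_zero]
      | mem x hx =>
        by_contra h0
        have h1 : n ∈ DFinsupp.support x := DFinsupp.mem_support_iff.mpr h0
        have h2 : n ≤ (DFinsupp.support x).sup id := Finset.le_sup (f := id) h1
        have h3 := Finset.le_sup (f := fun x : ⨁ n, M n => (DFinsupp.support x).sup id) hx
        have h4 := h2.trans h3
        omega
    refine ⟨fun a b => ?_⟩
    rw [← DirectSum.component.lof_self k n a, ← DirectSum.component.lof_self k n b, key, key]
  · rintro ⟨hf, N, hN⟩
    -- Only degrees below N contribute, so a finite sum of finite-dimensional spaces maps onto the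
    -- total space.
    refine Module.Finite.of_surjective
      (DirectSum.toModule k (Fin N) (⨁ n, M n) fun i => DirectSum.lof k ℕ M i) fun x => ?_
    induction x using DirectSum.induction_on with
    | zero => exact ⟨0, map_zero _⟩
    | of n a =>
      by_cases h : n < N
      · exact ⟨DirectSum.lof k (Fin N) (fun i => M i) ⟨n, h⟩ a, by rw [DirectSum.toModule_lof]; rfl⟩
      · have := hN n (by omega)
        exact ⟨0, by rw [Subsingleton.elim a 0, map_zero, map_zero]⟩
    | add x y hx hy =>
      obtain ⟨a, rfl⟩ := hx
      obtain ⟨b, rfl⟩ := hy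
      exact ⟨a + b, map_add _ _ _⟩

theorem IsTotallyFinite.of_injective {k : Type u} [Field k] {M M' : ℕ → Type u}
    [∀ n, AddCommGroup (M n)] [∀ n, Module k (M n)] [∀ n, AddCommGroup (M' n)]
    [∀ n, Module k (M' n)] (h : IsTotallyFinite k M') (f : ∀ n, M n →ₗ[k] M' n)
    (hf : ∀ n, Function.Injective (f n)) : IsTotallyFinite k M := by
  obtain ⟨h₁, N, h₂⟩ := isTotallyFinite_iff.mp h
  refine isTotallyFinite_iff.mpr ⟨fun n => Module.Finite.of_injective (f n) (hf n), N,
    fun n hn => ?_⟩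
  have := h₂ n hn
  exact (hf n).subsingleton

theorem IsTotallyFinite.of_surjective {k : Type u} [Field k] {M M' : ℕ → Type u}
    [∀ n, AddCommGroup (M n)] [∀ n, Module k (M n)] [∀ n, AddCommGroup (M' n)]
    [∀ n, Module k (M' n)] (h : IsTotallyFinite k M) (f : ∀ n, M n →ₗ[k] M' n)
    (hf : ∀ n, Function.Surjective (f n)) : IsTotallyFinite k M' := by
  obtain ⟨h₁, N, h₂⟩ := isTotallyFinite_iff.mp h
  refine isTotallyFinite_iff.mpr ⟨fun n => Module.Finite.of_surjective (f n) (hf n), N,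
    fun n hn => ?_⟩
  have := h₂ n hn
  exact (hf n).subsingleton

theorem IsTotallyFinite.prod {k : Type u} [Field k] {M M' : ℕ → Type u}
    [∀ n, AddCommGroup (M n)] [∀ n, Module k (M n)] [∀ n, AddCommGroup (M' n)]
    [∀ n, Module k (M' n)] (h : IsTotallyFinite k M) (h' : IsTotallyFinite k M') :
    IsTotallyFinite k (fun n => M n × M' n) := by
  obtain ⟨h₁, N, h₂⟩ := isTotallyFinite_iff.mp h
  obtain ⟨h₁', N', h₂'⟩ := isTotallyFinite_iff.mp h'
  refine isTotallyFinite_iff.mpr ⟨fun n => inferInstance, max N N', fun n hn => ?_⟩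
  have := h₂ n (le_trans (le_max_left _ _) hn)
  have := h₂' n (le_trans (le_max_right _ _) hn)
  infer_instance

theorem IsTotallyFinite.sup {k : Type u} [Field k] {M : ℕ → Type u} [∀ n, AddCommGroup (M n)]
    [∀ n, Module k (M n)] {S T : ∀ n, Submodule k (M n)} (hS : IsTotallyFinite k (fun n => S n))
    (hT : IsTotallyFinite k (fun n => T n)) :
    IsTotallyFinite k (fun n => (S n ⊔ T n : Submodule k (M n))) := by
  refine (hS.prod hT).of_surjective (fun n => LinearMap.coprod
    (Submodule.inclusion le_sup_left) (Submodule.inclusion le_sup_right)) fun n => ?_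
  rintro ⟨x, hx⟩
  obtain ⟨a, ha, b, hb, rfl⟩ := Submodule.mem_sup.mp hx
  exact ⟨(⟨a, ha⟩, ⟨b, hb⟩), rfl⟩

theorem isTotallyFinite_bot {k : Type u} [Field k] {M : ℕ → Type u} [∀ n, AddCommGroup (M n)]
    [∀ n, Module k (M n)] : IsTotallyFinite k (fun n => (⊥ : Submodule k (M n))) :=
  isTotallyFinite_iff.mpr ⟨fun _ => inferInstance, 0, fun _ _ => inferInstance⟩

/-! ### Elementwise identities for chain maps and for contractions of tensors -/

theorem HomologicalComplex.hom_d_apply {k : Type u} [Field k] {c : ComplexShape ℕ}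
    {V W : HomologicalComplex (ModuleCat.{u} k) c} (f : V ⟶ W) (i j : ℕ) (x : V.X i) :
    (f.f j).hom ((V.d i j).hom x) = (W.d i j).hom ((f.f i).hom x) := by
  rw [← ModuleCat.comp_apply, ← ModuleCat.comp_apply, f.comm]

theorem TensorProduct.lid_map_left {k M N P : Type*} [CommSemiring k] [AddCommMonoid M] [Module k M]
    [AddCommMonoid N] [Module k N] [AddCommMonoid P] [Module k P] (f : M →ₗ[k] k) (g : N →ₗ[k] P)
    (t : M ⊗[k] N) :
    TensorProduct.lid k P (TensorProduct.map f g t) =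
      g (TensorProduct.lid k N (f.rTensor N t)) := by
  induction t with
  | zero => simp
  | tmul x y => simp
  | add x y hx hy => simp only [map_add, hx, hy]

theorem TensorProduct.rid_map_right {k M N P : Type*} [CommSemiring k] [AddCommMonoid M] [Module k M]
    [AddCommMonoid N] [Module k N] [AddCommMonoid P] [Module k P] (f : M →ₗ[k] k) (g : N →ₗ[k] P)
    (t : N ⊗[k] M) :
    TensorProduct.rid k P (TensorProduct.map g f t) =
      g (TensorProduct.rid k N (f.lTensor N t)) := by
  induction t with
  | zero => simp
  | tmul x y => simp
  | add x y hx hy => simp only [map_add, hx, hy]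

/-! ### Colimits of coalgebras -/

namespace CDGC

variable {k : Type u} [Field k]

theorem Hom.congr_apply {C D : CDGC k} {f g : C ⟶ D} (h : f = g) (n : ℕ) (x : C.X.X n) :
    (f.f.f n).hom x = (g.f.f n).hom x := by rw [h]

theorem hom_ext_apply {C D : CDGC k} {f g : C ⟶ D}
    (h : ∀ n (x : C.X.X n), (f.f.f n).hom x = (g.f.f n).hom x) : f = g :=
  Hom.ext (HomologicalComplex.hom_ext _ _ fun n => ModuleCat.hom_ext (LinearMap.ext (h n)))

@[simp]
theorem comp_f {C D E : CDGC k} (f : C ⟶ D) (g : D ⟶ E) : (f ≫ g).f = f.f ≫ g.f := rfl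

section Colimit

variable {J : Type u} [Category.{u} J] {F : J ⥤ CDGC k}

/-- The structure maps of a cocone of underlying complexes, degreewise. -/
def coconeι (c : Cocone (F ⋙ forget k)) (j : J) (n : ℕ) : (F.obj j).X.X n →ₗ[k] c.pt.X n :=
  ((c.ι.app j).f n).hom

theorem coconeι_d (c : Cocone (F ⋙ forget k)) (j : J) (m n : ℕ) (x : (F.obj j).X.X m) :
    coconeι c j n (((F.obj j).X.d m n).hom x) = (c.pt.d m n).hom (coconeι c j m x) :=
  HomologicalComplex.hom_d_apply (c.ι.app j) m n x

theorem coconeι_map_apply (c : Cocone (F ⋙ forget k)) {i j : J} (a : i ⟶ j) (n : ℕ)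
    (x : (F.obj i).X.X n) :
    coconeι c j n (((F.map a).f.f n).hom x) = coconeι c i n x :=
  congrArg (fun t => ModuleCat.Hom.hom (HomologicalComplex.Hom.f t n) x) (c.w a)

theorem coconeι_comp_map (c : Cocone (F ⋙ forget k)) {i j : J} (a : i ⟶ j) (n : ℕ) :
    coconeι c j n ∘ₗ ((F.map a).f.f n).hom = coconeι c i n :=
  LinearMap.ext (coconeι_map_apply c a n)

variable {c : Cocone (F ⋙ forget k)} (hc : IsColimit c)

/-- Colimits of complexes are computed degreewise, so the images of the terms determine a linear map
in each degree. -/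
theorem coconeι_hom_ext (hc : IsColimit c) {n : ℕ} {M : Type u} [AddCommGroup M] [Module k M]
    {f g : c.pt.X n →ₗ[k] M}
    (h : ∀ j (x : (F.obj j).X.X n), f (coconeι c j n x) = g (coconeι c j n x)) : f = g := by
  have hcn := isColimitOfPreserves (HomologicalComplex.eval (ModuleCat.{u} k) _ n) hc
  have : ModuleCat.ofHom f = ModuleCat.ofHom g :=
    hcn.hom_ext fun j => ModuleCat.hom_ext (LinearMap.ext (h j))
  exact congrArg ModuleCat.Hom.hom this

/-- The linear map out of the degree `n` part of a colimit of complexes defined by a compatible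
family of linear maps. -/
def colimitDesc (n : ℕ) {M : Type u} [AddCommGroup M] [Module k M]
    (φ : ∀ j, (F.obj j).X.X n →ₗ[k] M)
    (hφ : ∀ i j (a : i ⟶ j) (x : (F.obj i).X.X n),
      φ j (((F.map a).f.f n).hom x) = φ i x) : c.pt.X n →ₗ[k] M :=
  ((isColimitOfPreserves (HomologicalComplex.eval (ModuleCat.{u} k) _ n) hc).desc
    { pt := ModuleCat.of k M
      ι :=
        { app := fun j => ModuleCat.ofHom (φ j)
          naturality := fun i j a => ModuleCat.hom_ext (LinearMap.ext fun x => hφ i j a x) } }).hom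

theorem colimitDesc_apply (n : ℕ) {M : Type u} [AddCommGroup M] [Module k M]
    (φ : ∀ j, (F.obj j).X.X n →ₗ[k] M)
    (hφ : ∀ i j (a : i ⟶ j) (x : (F.obj i).X.X n),
      φ j (((F.map a).f.f n).hom x) = φ i x) (j : J) (x : (F.obj j).X.X n) :
    colimitDesc hc n φ hφ (coconeι c j n x) = φ j x :=
  congrArg (fun t => ModuleCat.Hom.hom t x)
    ((isColimitOfPreserves (HomologicalComplex.eval (ModuleCat.{u} k) _ n) hc).fac _ j)

/-- The comultiplication of a colimit of coalgebras. -/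
def colimitComul (p q n : ℕ) (h : p + q = n) : c.pt.X n →ₗ[k] c.pt.X p ⊗[k] c.pt.X q :=
  colimitDesc hc n
    (fun j => TensorProduct.map (coconeι c j p) (coconeι c j q) ∘ₗ (F.obj j).comul p q n h)
    (fun i j a x => by
      rw [LinearMap.comp_apply, (F.map a).map_comul, ← LinearMap.comp_apply,
        ← TensorProduct.map_comp, coconeι_comp_map, coconeι_comp_map, LinearMap.comp_apply])

theorem colimitComul_apply (p q n : ℕ) (h : p + q = n) (j : J) (x : (F.obj j).X.X n) :
    colimitComul hc p q n h (coconeι c j n x) =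
      TensorProduct.map (coconeι c j p) (coconeι c j q) ((F.obj j).comul p q n h x) :=
  colimitDesc_apply hc n _ _ j x

/-- The counit of a colimit of coalgebras. -/
def colimitCounit : c.pt.X 0 →ₗ[k] k :=
  colimitDesc hc 0 (fun j => (F.obj j).counit) (fun _ _ a x => (F.map a).map_counit x)

theorem colimitCounit_apply (j : J) (x : (F.obj j).X.X 0) :
    colimitCounit hc (coconeι c j 0 x) = (F.obj j).counit x :=
  colimitDesc_apply hc 0 (fun j => (F.obj j).counit) (fun _ _ a x => (F.map a).map_counit x) j x

/-- The coalgebra structure on a colimit of complexes underlying a diagram of coalgebras. -/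
def colimitCoalgebra : CDGC k where
  X := c.pt
  comul := colimitComul hc
  counit := colimitCounit hc
  coassoc p q r m l n h₁ h₂ h₃ h₄ := by
    -- Both sides are linear in the element, so the axiom may be tested on the images of the terms,
    -- where it is transported from the axiom of the term. The other axioms are handled the same
    -- way.
    refine LinearMap.congr_fun
      (f := (TensorProduct.assoc k _ _ _).toLinearMap ∘ₗ
        (colimitComul hc p q m h₁).rTensor (c.pt.X r) ∘ₗ colimitComul hc m r n h₂)
      (g := (colimitComul hc q r l h₃).lTensor (c.pt.X p) ∘ₗ colimitComul hc p l n h₄)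
      (coconeι_hom_ext hc fun j x => ?_)
    have e₁ : colimitComul hc p q m h₁ ∘ₗ coconeι c j m =
        TensorProduct.map (coconeι c j p) (coconeι c j q) ∘ₗ (F.obj j).comul p q m h₁ :=
      LinearMap.ext (colimitComul_apply hc p q m h₁ j)
    have e₂ : colimitComul hc q r l h₃ ∘ₗ coconeι c j l =
        TensorProduct.map (coconeι c j q) (coconeι c j r) ∘ₗ (F.obj j).comul q r l h₃ :=
      LinearMap.ext (colimitComul_apply hc q r l h₃ j)
    have e := (F.obj j).coassoc p q r m l n h₁ h₂ h₃ h₄ x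
    simp only [LinearMap.comp_apply, LinearEquiv.coe_coe]
    rw [colimitComul_apply, colimitComul_apply, LinearMap.rTensor_map, e₁, LinearMap.lTensor_map,
      e₂, ← LinearMap.map_rTensor, ← LinearMap.map_lTensor, ← e, TensorProduct.map_map_assoc]
  counit_comul n := by
    refine LinearMap.congr_fun
      (f := (TensorProduct.lid k _).toLinearMap ∘ₗ (colimitCounit hc).rTensor (c.pt.X n) ∘ₗ
        colimitComul hc 0 n n (Nat.zero_add n)) (g := LinearMap.id)
      (coconeι_hom_ext hc fun j x => ?_)
    have e₁ : colimitCounit hc ∘ₗ coconeι c j 0 = (F.obj j).counit :=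
      LinearMap.ext (colimitCounit_apply hc j)
    simp only [LinearMap.comp_apply, LinearEquiv.coe_coe]
    rw [colimitComul_apply, LinearMap.rTensor_map, e₁, TensorProduct.lid_map_left,
      (F.obj j).counit_comul]
    rfl
  comul_counit n := by
    refine LinearMap.congr_fun
      (f := (TensorProduct.rid k _).toLinearMap ∘ₗ (colimitCounit hc).lTensor (c.pt.X n) ∘ₗ
        colimitComul hc n 0 n (Nat.add_zero n)) (g := LinearMap.id)
      (coconeι_hom_ext hc fun j x => ?_)
    have e₁ : colimitCounit hc ∘ₗ coconeι c j 0 = (F.obj j).counit :=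
      LinearMap.ext (colimitCounit_apply hc j)
    simp only [LinearMap.comp_apply, LinearEquiv.coe_coe]
    rw [colimitComul_apply, LinearMap.lTensor_map, e₁, TensorProduct.rid_map_right,
      (F.obj j).comul_counit]
    rfl
  cocomm p q n h h' := by
    refine LinearMap.congr_fun
      (f := (TensorProduct.comm k _ _).toLinearMap ∘ₗ colimitComul hc p q n h)
      (g := (-1 : k) ^ (p * q) • colimitComul hc q p n h')
      (coconeι_hom_ext hc fun j x => ?_)
    simp only [LinearMap.comp_apply, LinearEquiv.coe_coe, LinearMap.smul_apply]
    rw [colimitComul_apply, colimitComul_apply, ← TensorProduct.map_comm,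
      (F.obj j).cocomm p q n h h', map_smul]
  comul_d p q n h h₁ h₂ := by
    refine LinearMap.congr_fun
      (f := colimitComul hc p q n h ∘ₗ (c.pt.d (n + 1) n).hom)
      (g := (c.pt.d (p + 1) p).hom.rTensor (c.pt.X q) ∘ₗ colimitComul hc (p + 1) q (n + 1) h₁ +
        (-1 : k) ^ p • (c.pt.d (q + 1) q).hom.lTensor (c.pt.X p) ∘ₗ
          colimitComul hc p (q + 1) (n + 1) h₂)
      (coconeι_hom_ext hc fun j x => ?_)
    simp only [LinearMap.comp_apply, LinearMap.add_apply, LinearMap.smul_apply]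
    rw [← coconeι_d, colimitComul_apply, colimitComul_apply, colimitComul_apply,
      (F.obj j).comul_d p q n h h₁ h₂, map_add, map_smul, LinearMap.map_rTensor, LinearMap.map_lTensor,
      LinearMap.rTensor_map, LinearMap.lTensor_map]
    have e : ∀ n, coconeι c j n ∘ₗ ((F.obj j).X.d (n + 1) n).hom =
        (c.pt.d (n + 1) n).hom ∘ₗ coconeι c j (n + 1) := fun n =>
      LinearMap.ext (coconeι_d c j (n + 1) n)
    rw [e, e]
  counit_d := by
    refine LinearMap.congr_fun (f := colimitCounit hc ∘ₗ (c.pt.d 1 0).hom) (g := 0)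
      (coconeι_hom_ext hc fun j x => ?_)
    rw [LinearMap.comp_apply, ← coconeι_d, colimitCounit_apply, (F.obj j).counit_d]
    rfl

/-- The cocone of coalgebras over a colimit of underlying complexes. -/
def colimitCocone : Cocone F where
  pt := colimitCoalgebra hc
  ι :=
    { app := fun j =>
        { f := c.ι.app j
          map_comul := fun p q n h x => colimitComul_apply hc p q n h j x
          map_counit := fun x => colimitCounit_apply hc j x }
      naturality := fun _ _ a => Hom.ext (c.ι.naturality a) }

/-- A chain map out of a colimit which restricts to coalgebra maps is a coalgebra map. -/
def colimitHom {Z : CDGC k} (m : c.pt ⟶ Z.X) (φ : ∀ j, F.obj j ⟶ Z)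
    (hm : ∀ j n, (m.f n).hom ∘ₗ coconeι c j n = ((φ j).f.f n).hom) :
    colimitCoalgebra hc ⟶ Z where
  f := m
  map_comul p q n h := by
    refine LinearMap.congr_fun
      (f := Z.comul p q n h ∘ₗ (m.f n).hom)
      (g := TensorProduct.map (m.f p).hom (m.f q).hom ∘ₗ colimitComul hc p q n h)
      (coconeι_hom_ext hc fun j x => ?_)
    rw [LinearMap.comp_apply, LinearMap.comp_apply, colimitComul_apply,
      TensorProduct.map_map, hm, hm, ← (φ j).map_comul, ← hm]
    rfl
  map_counit := by
    refine LinearMap.congr_fun (f := Z.counit ∘ₗ (m.f 0).hom) (g := colimitCounit hc)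
      (coconeι_hom_ext hc fun j x => ?_)
    rw [LinearMap.comp_apply, colimitCounit_apply, ← (φ j).map_counit, ← hm]
    rfl

/-- The forgetful functor creates colimits. -/
def isColimitColimitCocone : IsColimit (colimitCocone hc) where
  desc s := colimitHom hc (hc.desc ((forget k).mapCocone s)) s.ι.app fun j n =>
    congrArg (fun t => ModuleCat.Hom.hom (HomologicalComplex.Hom.f t n))
      (hc.fac ((forget k).mapCocone s) j)
  fac s j := Hom.ext (hc.fac _ j)
  uniq s m hm := Hom.ext (hc.uniq ((forget k).mapCocone s) m.f fun j => congrArg Hom.f (hm j))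

end Colimit

instance {J : Type u} [Category.{u} J] : HasColimitsOfShape J (CDGC k) where
  has_colimit F := ⟨⟨⟨_, isColimitColimitCocone (colimit.isColimit (F ⋙ forget k))⟩⟩⟩

instance {J : Type u} [Category.{u} J] : PreservesColimitsOfShape J (forget k) where
  preservesColimit {F} := preservesColimit_of_preserves_colimit_cocone
    (isColimitColimitCocone (colimit.isColimit (F ⋙ forget k)))
    -- Forgetting the coalgebra structure of the colimit cocone returns the cocone of complexes it
    -- was built on.
    ((colimit.isColimit (F ⋙ forget k)).ofIsoColimit (Cocone.ext (Iso.refl _)))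

end CDGC

/-! ### Slices of tensors -/

section Slices

variable {k : Type*} [Field k] {M N P A B : Type*} [AddCommGroup M] [Module k M]
  [AddCommGroup N] [Module k N] [AddCommGroup P] [Module k P] [AddCommGroup A] [Module k A]
  [AddCommGroup B] [Module k B]

/-- Contraction of the right factor with a linear form. -/
def rightSlice (f : Module.Dual k N) : M ⊗[k] N →ₗ[k] M :=
  (TensorProduct.rid k M).toLinearMap ∘ₗ f.lTensor M

/-- Contraction of the left factor with a linear form. -/
def leftSlice (f : Module.Dual k M) : M ⊗[k] N →ₗ[k] N :=
  (TensorProduct.lid k N).toLinearMap ∘ₗ f.rTensor N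

@[simp]
theorem rightSlice_tmul (f : Module.Dual k N) (x : M) (y : N) :
    rightSlice f (x ⊗ₜ[k] y) = f y • x := rfl

@[simp]
theorem leftSlice_tmul (f : Module.Dual k M) (x : M) (y : N) :
    leftSlice f (x ⊗ₜ[k] y) = f x • y := rfl

theorem leftSlice_eq (f : Module.Dual k M) (t : M ⊗[k] N) :
    leftSlice f t = rightSlice f (TensorProduct.comm k M N t) := by
  induction t with
  | zero => simp
  | tmul x y => simp
  | add x y hx hy => simp only [map_add, hx, hy]

theorem rightSlice_map (φ : M →ₗ[k] A) (ψ : N →ₗ[k] B) (f : Module.Dual k B) (t : M ⊗[k] N) :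
    rightSlice f (TensorProduct.map φ ψ t) = φ (rightSlice (f ∘ₗ ψ) t) := by
  induction t with
  | zero => simp
  | tmul x y => simp
  | add x y hx hy => simp only [map_add, hx, hy]

/-- Slicing twice is slicing once against a product form. With C a comultiplication, this puts
iterated slices in the shape to which coassociativity applies. -/
theorem rightSlice_comp_rightSlice (C : M →ₗ[k] A ⊗[k] B) (g : Module.Dual k B)
    (f : Module.Dual k P) (t : M ⊗[k] P) :
    rightSlice g (C (rightSlice f t)) =
      rightSlice (LinearMap.mul' k k ∘ₗ TensorProduct.map g f)
        (TensorProduct.assoc k A B P (C.rTensor P t)) := by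
  induction t with
  | zero => simp
  | tmul x y =>
    rw [rightSlice_tmul, LinearMap.rTensor_tmul, map_smul, map_smul]
    generalize C x = s
    induction s with
    | zero => simp
    | tmul a b => simp [smul_smul, mul_comm]
    | add a b ha hb => simp only [map_add, TensorProduct.add_tmul, smul_add, ha, hb]
  | add x y hx hy => simp only [map_add, hx, hy]

/-- A basis of N identifies M ⊗ N with finitely supported families in M, whose entries are the
slices by the coordinate forms. -/
theorem eq_of_rightSlice {s t : M ⊗[k] N}
    (h : ∀ f : Module.Dual k N, rightSlice f s = rightSlice f t) : s = t := by
  classical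
  let b := Module.Basis.ofVectorSpace k N
  refine (TensorProduct.equivFinsuppOfBasisRight (M := M) b).injective (Finsupp.ext fun i => ?_)
  have key : ∀ u : M ⊗[k] N,
      TensorProduct.equivFinsuppOfBasisRight (M := M) b u i = rightSlice (b.coord i) u := by
    intro u
    induction u with
    | zero => simp
    | tmul x y => simp
    | add x y hx hy => simp only [map_add, Finsupp.add_apply, hx, hy]
  rw [key, key, h]

theorem eq_of_leftSlice {s t : M ⊗[k] N}
    (h : ∀ f : Module.Dual k M, leftSlice f s = leftSlice f t) : s = t :=
  (TensorProduct.comm k M N).injective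
    (eq_of_rightSlice fun f => by rw [← leftSlice_eq, ← leftSlice_eq, h])

theorem exists_projection (S : Submodule k M) :
    ∃ π : M →ₗ[k] S, ∀ x ∈ S, S.subtype (π x) = x := by
  obtain ⟨π, hπ⟩ := S.subtype.exists_leftInverse_of_injective S.ker_subtype
  exact ⟨π, fun x hx => congrArg S.subtype (LinearMap.congr_fun hπ ⟨x, hx⟩)⟩

/-- Over a field S and T are direct summands. If all slices lie in S and T, the projections applied
to either factor fix the tensor, which therefore comes from S ⊗ T. -/
theorem mem_range_map_subtype {S : Submodule k M} {T : Submodule k N} {t : M ⊗[k] N}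
    (hS : ∀ f : Module.Dual k N, rightSlice f t ∈ S)
    (hT : ∀ f : Module.Dual k M, leftSlice f t ∈ T) :
    t ∈ LinearMap.range (TensorProduct.map S.subtype T.subtype) := by
  obtain ⟨π, hπ⟩ := exists_projection S
  obtain ⟨ρ, hρ⟩ := exists_projection T
  have h₁ : (S.subtype ∘ₗ π).rTensor N t = t := eq_of_rightSlice fun f =>
    (rightSlice_map _ _ f t).trans (hπ _ (hS f))
  have h₂ : (T.subtype ∘ₗ ρ).lTensor M t = t := eq_of_leftSlice fun f => by
    rw [leftSlice_eq]
    have e : TensorProduct.comm k M N ((T.subtype ∘ₗ ρ).lTensor M t) =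
        (T.subtype ∘ₗ ρ).rTensor M (TensorProduct.comm k M N t) :=
      (TensorProduct.map_comm _ _ _).symm
    rw [e]
    refine (rightSlice_map _ _ f _).trans ?_
    rw [leftSlice_eq]
    exact hρ _ (leftSlice_eq f t ▸ hT f)
  refine ⟨TensorProduct.map π ρ t, ?_⟩
  rw [TensorProduct.map_map, ← LinearMap.rTensor_comp_lTensor, LinearMap.comp_apply, h₂, h₁]

theorem map_mem_range_map {S : Submodule k M} {T : Submodule k N} {S' : Submodule k A}
    {T' : Submodule k B} {φ : M →ₗ[k] A} {ψ : N →ₗ[k] B} (hφ : ∀ x ∈ S, φ x ∈ S')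
    (hψ : ∀ x ∈ T, ψ x ∈ T') {t : M ⊗[k] N}
    (ht : t ∈ LinearMap.range (TensorProduct.map S.subtype T.subtype)) :
    TensorProduct.map φ ψ t ∈ LinearMap.range (TensorProduct.map S'.subtype T'.subtype) := by
  obtain ⟨u, rfl⟩ := ht
  refine ⟨TensorProduct.map (φ.restrict hφ) (ψ.restrict hψ) u, ?_⟩
  rw [TensorProduct.map_map, TensorProduct.map_map]
  rfl

theorem range_map_subtype_mono {S S' : Submodule k M} {T T' : Submodule k N} (hS : S ≤ S')
    (hT : T ≤ T') {t : M ⊗[k] N}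
    (ht : t ∈ LinearMap.range (TensorProduct.map S.subtype T.subtype)) :
    t ∈ LinearMap.range (TensorProduct.map S'.subtype T'.subtype) := by
  have := map_mem_range_map (φ := LinearMap.id) (ψ := LinearMap.id) hS hT ht
  rwa [TensorProduct.map_id] at this

/-- A tensor is a finite sum of pure tensors, and every slice lies in the span of their left
factors. -/
theorem exists_finite_rightSlice_mem (t : M ⊗[k] N) :
    ∃ S : Submodule k M, Module.Finite k S ∧ ∀ f : Module.Dual k N, rightSlice f t ∈ S := by
  induction t with
  | zero => exact ⟨⊥, inferInstance, fun f => by simp⟩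
  | tmul x y =>
    exact ⟨Submodule.span k {x}, inferInstance, fun f =>
      Submodule.smul_mem _ _ (Submodule.mem_span_singleton_self x)⟩
  | add x y hx hy =>
    obtain ⟨S, hS, hx⟩ := hx
    obtain ⟨T, hT, hy⟩ := hy
    exact ⟨S ⊔ T, inferInstance, fun f => by
      rw [map_add]
      exact add_mem (Submodule.mem_sup_left (hx f)) (Submodule.mem_sup_right (hy f))⟩

theorem map_subtype_injective (S : Submodule k M) (T : Submodule k N) :
    Function.Injective (TensorProduct.map S.subtype T.subtype) := 
  TensorProduct.map_injective_of_flat_flat _ _ S.injective_subtype T.injective_subtype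

/-- Corestriction of a map to a tensor product to the tensor product of two subspaces. -/
def tensorCodRestrict (S : Submodule k M) (T : Submodule k N) (f : P →ₗ[k] M ⊗[k] N)
    (hf : ∀ x, f x ∈ LinearMap.range (TensorProduct.map S.subtype T.subtype)) :
    P →ₗ[k] S ⊗[k] T :=
  (LinearEquiv.ofInjective _ (map_subtype_injective S T)).symm.toLinearMap ∘ₗ
    f.codRestrict _ hf

theorem map_tensorCodRestrict (S : Submodule k M) (T : Submodule k N) (f : P →ₗ[k] M ⊗[k] N)
    (hf : ∀ x, f x ∈ LinearMap.range (TensorProduct.map S.subtype T.subtype)) (x : P) :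
    TensorProduct.map S.subtype T.subtype (tensorCodRestrict S T f hf x) = f x := by
  have := (LinearEquiv.ofInjective _ (map_subtype_injective S T)).apply_symm_apply
    (f.codRestrict _ hf x)
  exact congrArg Subtype.val this

end Slices

/-! ### Finite-dimensional subcoalgebras -/

namespace CDGC

variable {k : Type u} [Field k]

/-- A finite-dimensional differential graded subcoalgebra. -/
structure FiniteSubcoalgebra (X : CDGC k) where
  S (n : ℕ) : Submodule k (X.X.X n)
  d_mem : ∀ (i j : ℕ), ∀ x ∈ S i, (X.X.d i j).hom x ∈ S j
  comul_mem : ∀ (p q n : ℕ) (h : p + q = n), ∀ x ∈ S n,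
    X.comul p q n h x ∈ LinearMap.range (TensorProduct.map (S p).subtype (S q).subtype)
  finite : IsTotallyFinite k (fun n => S n)

namespace FiniteSubcoalgebra

variable {X : CDGC k} (E : FiniteSubcoalgebra X)

/-- The comultiplication of a subcoalgebra. -/
def comul (p q n : ℕ) (h : p + q = n) : E.S n →ₗ[k] E.S p ⊗[k] E.S q :=
  tensorCodRestrict (E.S p) (E.S q) (X.comul p q n h ∘ₗ (E.S n).subtype)
    fun x => E.comul_mem p q n h x.1 x.2

theorem map_comul (p q n : ℕ) (h : p + q = n) (x : E.S n) :
    TensorProduct.map (E.S p).subtype (E.S q).subtype (E.comul p q n h x) =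
      X.comul p q n h x.1 :=
  map_tensorCodRestrict _ _ _ _ x

theorem comp_comul (p q n : ℕ) (h : p + q = n) :
    TensorProduct.map (E.S p).subtype (E.S q).subtype ∘ₗ E.comul p q n h =
      X.comul p q n h ∘ₗ (E.S n).subtype :=
  LinearMap.ext (E.map_comul p q n h)

/-- The differential of a subcoalgebra. -/
def diff (i j : ℕ) : E.S i →ₗ[k] E.S j := (X.X.d i j).hom.restrict (E.d_mem i j)

/-- The underlying complex of a subcoalgebra. -/
def complex : ChainComplex (ModuleCat.{u} k) ℕ where
  X n := ModuleCat.of k (E.S n)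
  d i j := ModuleCat.ofHom (E.diff i j)
  shape i j h := by
    refine ModuleCat.hom_ext (LinearMap.ext fun x => Subtype.ext (p := (· ∈ E.S j)) ?_)
    change (X.X.d i j).hom x.1 = 0
    rw [X.X.shape i j h]
    rfl
  d_comp_d' i j l _ _ :=
    ModuleCat.hom_ext (LinearMap.ext fun x => Subtype.ext (p := (· ∈ E.S l))
      (X.X.d_hom_d_hom i j l x.1))

/-- The counit of a subcoalgebra. -/
def counit : E.S 0 →ₗ[k] k := X.counit ∘ₗ (E.S 0).subtype

/-- Over a field the inclusions stay injective after tensoring, so each axiom may be checked in the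
ambient coalgebra. The remaining axioms follow in the same way. -/
theorem coassoc (p q r m l n : ℕ) (h₁ : p + q = m) (h₂ : m + r = n) (h₃ : q + r = l)
    (h₄ : p + l = n) (x : E.S n) :
    TensorProduct.assoc k (E.S p) (E.S q) (E.S r)
        ((E.comul p q m h₁).rTensor (E.S r) (E.comul m r n h₂ x)) =
      (E.comul q r l h₃).lTensor (E.S p) (E.comul p l n h₄ x) := by
  have hi : Function.Injective (TensorProduct.map (E.S p).subtype
      (TensorProduct.map (E.S q).subtype (E.S r).subtype)) :=
    TensorProduct.map_injective_of_flat_flat _ _ (E.S p).injective_subtype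
      (map_subtype_injective _ _)
  apply hi
  rw [TensorProduct.map_map_assoc, LinearMap.map_rTensor, LinearMap.map_lTensor, comp_comul,
    comp_comul, ← LinearMap.rTensor_map, ← LinearMap.lTensor_map, map_comul, map_comul,
    X.coassoc p q r m l n h₁ h₂ h₃ h₄]

theorem counit_comul (n : ℕ) (x : E.S n) :
    TensorProduct.lid k (E.S n)
      (E.counit.rTensor (E.S n) (E.comul 0 n n (Nat.zero_add n) x)) = x := by
  apply (E.S n).injective_subtype
  rw [← TensorProduct.lid_map_left, counit, ← LinearMap.rTensor_map, map_comul, X.counit_comul]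
  rfl

theorem comul_counit (n : ℕ) (x : E.S n) :
    TensorProduct.rid k (E.S n)
      (E.counit.lTensor (E.S n) (E.comul n 0 n (Nat.add_zero n) x)) = x := by
  apply (E.S n).injective_subtype
  rw [← TensorProduct.rid_map_right, counit, ← LinearMap.lTensor_map, map_comul, X.comul_counit]
  rfl

theorem cocomm (p q n : ℕ) (h : p + q = n) (h' : q + p = n) (x : E.S n) :
    TensorProduct.comm k (E.S p) (E.S q) (E.comul p q n h x) =
      (-1 : k) ^ (p * q) • E.comul q p n h' x := by
  apply map_subtype_injective
  rw [TensorProduct.map_comm, map_comul, map_smul, map_comul, X.cocomm p q n h h']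

theorem comul_diff (p q n : ℕ) (h : p + q = n) (h₁ : (p + 1) + q = n + 1)
    (h₂ : p + (q + 1) = n + 1) (x : E.S (n + 1)) :
    E.comul p q n h (E.diff (n + 1) n x) =
      (E.diff (p + 1) p).rTensor (E.S q) (E.comul (p + 1) q (n + 1) h₁ x) +
        (-1 : k) ^ p • (E.diff (q + 1) q).lTensor (E.S p) (E.comul p (q + 1) (n + 1) h₂ x) := by
  have e : ∀ n, (E.S n).subtype ∘ₗ E.diff (n + 1) n =
    (X.X.d (n + 1) n).hom ∘ₗ (E.S (n + 1)).subtype := fun _ => rfl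
  apply map_subtype_injective
  rw [map_add, map_smul, map_comul, LinearMap.map_rTensor, LinearMap.map_lTensor, e, e,
    ← LinearMap.rTensor_map, ← LinearMap.lTensor_map, map_comul, map_comul,
    ← X.comul_d p q n h h₁ h₂]
  rfl

/-- A finite-dimensional subcoalgebra as a coalgebra. -/
def toCDGC : CDGC k where
  X := E.complex
  comul := E.comul
  counit := E.counit
  coassoc := E.coassoc
  counit_comul := E.counit_comul
  comul_counit := E.comul_counit
  cocomm := E.cocomm
  comul_d := E.comul_diff
  counit_d x := X.counit_d x.1

/-- The inclusion of a finite-dimensional subcoalgebra. -/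
def incl : E.toCDGC ⟶ X where
  f :=
    { f := fun n => ModuleCat.ofHom (E.S n).subtype
      comm' := fun _ _ _ => rfl }
  map_comul p q n h x := (E.map_comul p q n h x).symm
  map_counit _ := rfl

theorem isFiniteDim : E.toCDGC.X.IsFiniteDim := E.finite

theorem incl_injective (n : ℕ) : Function.Injective (E.incl.f.f n).hom :=
  (E.S n).injective_subtype

theorem incl_mem (n : ℕ) (x : E.toCDGC.X.X n) : (E.incl.f.f n).hom x ∈ E.S n := x.2

theorem exists_incl_eq {n : ℕ} {x : X.X.X n} (hx : x ∈ E.S n) :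
    ∃ y : E.toCDGC.X.X n, (E.incl.f.f n).hom y = x :=
  ⟨⟨x, hx⟩, rfl⟩

/-- Corestriction of a coalgebra map to a finite-dimensional subcoalgebra. -/
def lift {D : CDGC k} (g : D ⟶ X) (hg : ∀ n x, (g.f.f n).hom x ∈ E.S n) : D ⟶ E.toCDGC where
  f :=
    { f := fun n => ModuleCat.ofHom ((g.f.f n).hom.codRestrict (E.S n) (hg n))
      comm' := fun i j _ => ModuleCat.hom_ext (LinearMap.ext fun x =>
        Subtype.ext (p := (· ∈ E.S j)) (HomologicalComplex.hom_d_apply g.f i j x).symm) }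
  map_comul p q n h x := by
    refine map_subtype_injective _ _ ((E.map_comul p q n h _).trans ((g.map_comul p q n h x).trans
      ?_))
    exact (TensorProduct.map_map (E.S p).subtype (E.S q).subtype
      ((g.f.f p).hom.codRestrict (E.S p) (hg p)) ((g.f.f q).hom.codRestrict (E.S q) (hg q)) _).symm
  map_counit x := g.map_counit x

theorem lift_incl {D : CDGC k} (g : D ⟶ X) (hg : ∀ n x, (g.f.f n).hom x ∈ E.S n) :
    E.lift g hg ≫ E.incl = g := rfl

/-- The inclusion between two finite-dimensional subcoalgebras. -/
def inclusion {E E' : FiniteSubcoalgebra X} (h : ∀ n, E.S n ≤ E'.S n) : E.toCDGC ⟶ E'.toCDGC :=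
  E'.lift E.incl fun n x => h n (E.incl_mem n x)

/-- The sum of two finite-dimensional subcoalgebras. -/
def sup (E E' : FiniteSubcoalgebra X) : FiniteSubcoalgebra X where
  S n := E.S n ⊔ E'.S n
  d_mem i j x hx := by
    obtain ⟨a, ha, b, hb, rfl⟩ := Submodule.mem_sup.mp hx
    rw [map_add]
    exact add_mem (Submodule.mem_sup_left (E.d_mem i j a ha))
      (Submodule.mem_sup_right (E'.d_mem i j b hb))
  comul_mem p q n h x hx := by
    obtain ⟨a, ha, b, hb, rfl⟩ := Submodule.mem_sup.mp hx
    rw [map_add]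
    exact add_mem (range_map_subtype_mono le_sup_left le_sup_left (E.comul_mem p q n h a ha))
      (range_map_subtype_mono le_sup_right le_sup_right (E'.comul_mem p q n h b hb))
  finite := E.finite.sup E'.finite

/-- The zero subcoalgebra. -/
def bot (X : CDGC k) : FiniteSubcoalgebra X where
  S n := ⊥
  d_mem i j x hx := by
    rw [(Submodule.mem_bot k).mp hx, map_zero]
    exact zero_mem _
  comul_mem p q n h x hx := by
    rw [(Submodule.mem_bot k).mp hx, map_zero]
    exact zero_mem _
  finite := isTotallyFinite_bot

end FiniteSubcoalgebra

/-- The slices `(id ⊗ f) (Δ x)` of the comultiplication of an element. -/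
def slices {X : CDGC k} {n : ℕ} (x : X.X.X n) (p : ℕ) : Submodule k (X.X.X p) :=
  ⨆ (q : ℕ) (h : p + q = n), Submodule.span k
    (Set.range fun f : Module.Dual k (X.X.X q) => rightSlice f (X.comul p q n h x))

/-- Only one q satisfies p + q = n, so the supremum has a single term; it serves to avoid truncated
subtraction of degrees. -/
theorem slices_eq {X : CDGC k} {n : ℕ} (x : X.X.X n) (p q : ℕ) (h : p + q = n) :
    slices x p = Submodule.span k
      (Set.range fun f : Module.Dual k (X.X.X q) => rightSlice f (X.comul p q n h x)) := by
  refine le_antisymm (iSup₂_le fun q' h' => ?_) (le_iSup₂_of_le q h le_rfl)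
  obtain rfl : q' = q := by omega
  exact le_rfl

theorem slices_eq_bot {X : CDGC k} {n : ℕ} (x : X.X.X n) (p : ℕ) (h : n < p) :
    slices x p = ⊥ :=
  le_bot_iff.mp (iSup₂_le fun q h' => by omega)

theorem rightSlice_mem_slices {X : CDGC k} {n : ℕ} (x : X.X.X n) (p q : ℕ) (h : p + q = n)
    (f : Module.Dual k (X.X.X q)) : rightSlice f (X.comul p q n h x) ∈ slices x p := by
  rw [slices_eq x p q h]
  exact Submodule.subset_span ⟨f, rfl⟩

/-- Slicing with the counit gives the element back. -/
theorem mem_slices_self {X : CDGC k} {n : ℕ} (x : X.X.X n) : x ∈ slices x n := by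
  have := rightSlice_mem_slices x n 0 (Nat.add_zero n) X.counit
  rwa [rightSlice, LinearMap.comp_apply, LinearEquiv.coe_coe, X.comul_counit] at this

theorem isTotallyFinite_slices {X : CDGC k} {n : ℕ} (x : X.X.X n) :
    IsTotallyFinite k (fun p => slices x p) := by
  refine isTotallyFinite_iff.mpr ⟨fun p => ?_, n + 1, fun p hp => ?_⟩
  · by_cases h : p ≤ n
    · obtain ⟨S, hS, hx⟩ := exists_finite_rightSlice_mem
        (X.comul p (n - p) n (Nat.add_sub_cancel' h) x)
      rw [slices_eq x p (n - p) (Nat.add_sub_cancel' h)]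
      have hle := Submodule.span_le.mpr (Set.range_subset_iff.mpr hx)
      exact Module.Finite.of_injective _ (Submodule.inclusion_injective hle)
    · rw [slices_eq_bot x p (by omega)]
      infer_instance
  · rw [slices_eq_bot x p (by omega)]
    infer_instance

/-- By coassociativity, slicing Δ of a slice (id ⊗ f)(Δ x) by g is slicing Δ x by the form (g ⊗ f) ∘
Δ. -/
theorem rightSlice_comul_mem_slices {X : CDGC k} {n : ℕ} (x : X.X.X n) (p' p'' p : ℕ)
    (h : p' + p'' = p) (y : X.X.X p) (hy : y ∈ slices x p) (g : Module.Dual k (X.X.X p'')) :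
    rightSlice g (X.comul p' p'' p h y) ∈ slices x p' := by
  by_cases hp : p ≤ n
  · obtain ⟨q, hq⟩ := Nat.exists_eq_add_of_le hp
    rw [slices_eq x p q hq.symm] at hy
    induction hy using Submodule.span_induction with
    | zero => rw [map_zero, map_zero]; exact zero_mem _
    | add a b _ _ ha hb => rw [map_add, map_add]; exact add_mem ha hb
    | smul c a _ ha => rw [map_smul, map_smul]; exact Submodule.smul_mem _ c ha
    | mem a ha =>
      obtain ⟨f, rfl⟩ := ha
      change rightSlice g (X.comul p' p'' p h (rightSlice f _)) ∈ _
      rw [rightSlice_comp_rightSlice,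
        X.coassoc p' p'' q p (p'' + q) n h hq.symm rfl (by omega)]
      -- The second comultiplication acts only on the contracted factor, so it is absorbed into the
      -- form.
      have e := rightSlice_map LinearMap.id (X.comul p'' q (p'' + q) rfl)
        (LinearMap.mul' k k ∘ₗ TensorProduct.map g f) (X.comul p' (p'' + q) n (by omega) x)
      refine e ▸ ?_
      exact rightSlice_mem_slices x p' (p'' + q) _ _
  · rw [slices_eq_bot x p (by omega)] at hy
    rw [(Submodule.mem_bot k).mp hy, map_zero, map_zero]
    exact zero_mem _

/-- It suffices that both kinds of slices of Δ y stay in the family. Cocommutativity turns left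
slices into right slices up to sign. -/
theorem comul_mem_slices {X : CDGC k} {n : ℕ} (x : X.X.X n) (p' p'' p : ℕ)
    (h : p' + p'' = p) (y : X.X.X p) (hy : y ∈ slices x p) :
    X.comul p' p'' p h y ∈
      LinearMap.range (TensorProduct.map (slices x p').subtype (slices x p'').subtype) := by
  refine mem_range_map_subtype (rightSlice_comul_mem_slices x p' p'' p h y hy) fun g => ?_
  rw [leftSlice_eq, X.cocomm p' p'' p h (by omega), map_smul]
  exact Submodule.smul_mem _ _ (rightSlice_comul_mem_slices x p'' p' p _ y hy g)

/-- The finite-dimensional differential graded subcoalgebra generated by an element. -/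
def FiniteSubcoalgebra.generated {X : CDGC k} {n : ℕ} (x : X.X.X n) : FiniteSubcoalgebra X where
  S p := slices x p ⊔ (slices x (p + 1)).map (X.X.d (p + 1) p).hom
  d_mem i j y hy := by
    by_cases hij : j + 1 = i
    · subst hij
      obtain ⟨a, ha, b, hb, rfl⟩ := Submodule.mem_sup.mp hy
      obtain ⟨c, -, rfl⟩ := hb
      -- Since d² = 0, the boundary summand contributes nothing new.
      rw [map_add, X.X.d_hom_d_hom, add_zero]
      exact Submodule.mem_sup_right ⟨a, ha, rfl⟩
    · rw [X.X.shape i j hij]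
      exact zero_mem _
  comul_mem p q m h y hy := by
    obtain ⟨a, ha, b, hb, rfl⟩ := Submodule.mem_sup.mp hy
    obtain ⟨c, hc, rfl⟩ := hb
    rw [map_add]
    refine add_mem (range_map_subtype_mono le_sup_left le_sup_left
      (comul_mem_slices x p q m h a ha)) ?_
    -- As Δ commutes with d, Δ (d c) is d ⊗ 1 ± 1 ⊗ d applied to Δ c, so in each term one factor is
    -- a slice and the other the boundary of a slice.
    rw [X.comul_d p q m h (by omega) (by omega)]
    refine add_mem ?_ (Submodule.smul_mem _ _ ?_)
    · exact map_mem_range_map (fun z hz => Submodule.mem_sup_right (Submodule.mem_map_of_mem hz))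
        (fun z hz => Submodule.mem_sup_left hz) (comul_mem_slices x (p + 1) q (m + 1) _ c hc)
    · exact map_mem_range_map (fun z hz => Submodule.mem_sup_left hz)
        (fun z hz => Submodule.mem_sup_right (Submodule.mem_map_of_mem hz))
        (comul_mem_slices x p (q + 1) (m + 1) _ c hc)
  finite := by
    refine (isTotallyFinite_slices x).sup ?_
    obtain ⟨h₁, N, h₂⟩ := isTotallyFinite_iff.mp (isTotallyFinite_slices x)
    -- The bound for the slices also serves their boundaries: degree p comes from slices in degree p
    -- + 1 > N.
    refine isTotallyFinite_iff.mpr ⟨fun p => ?_, N, fun p hp => ?_⟩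
    · have := h₁ (p + 1)
      infer_instance
    · have := h₂ (p + 1) (by omega)
      rw [(Submodule.subsingleton_iff_eq_bot).mp this, Submodule.map_bot]
      infer_instance

theorem FiniteSubcoalgebra.mem_generated {X : CDGC k} {n : ℕ} (x : X.X.X n) :
    x ∈ (generated x).S n :=
  Submodule.mem_sup_left (mem_slices_self x)

theorem FiniteSubcoalgebra.exists_le_of_finite {X : CDGC k} {n : ℕ} (M : Submodule k (X.X.X n))
    [Module.Finite k M] : ∃ E : FiniteSubcoalgebra X, M ≤ E.S n := by
  have hM : M.FG := Module.Finite.iff_fg.mp inferInstance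
  induction M, hM using Submodule.fg_induction with
  | singleton x =>
    exact ⟨generated x, (Submodule.span_singleton_le_iff_mem _ _).mpr (mem_generated x)⟩
  | sup M M' h h' h₁ h₂ =>
    have := Module.Finite.iff_fg.mpr h
    have := Module.Finite.iff_fg.mpr h'
    obtain ⟨E, hE⟩ := h₁
    obtain ⟨E', hE'⟩ := h₂
    exact ⟨E.sup E', sup_le_sup hE hE'⟩

/-- Only finitely many degrees are nonzero; subcoalgebras containing each of them are added up
degree by degree. -/
theorem FiniteSubcoalgebra.exists_le {X : CDGC k} (M : ∀ n, Submodule k (X.X.X n))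
    (hM : IsTotallyFinite k (fun n => M n)) :
    ∃ E : FiniteSubcoalgebra X, ∀ n, M n ≤ E.S n := by
  obtain ⟨h₁, N, h₂⟩ := isTotallyFinite_iff.mp hM
  have key : ∀ m, ∃ E : FiniteSubcoalgebra X, ∀ n < m, M n ≤ E.S n := by
    intro m
    induction m with
    | zero => exact ⟨bot X, fun n hn => by omega⟩
    | succ m ih =>
      obtain ⟨E, hE⟩ := ih
      have := h₁ m
      obtain ⟨E', hE'⟩ := exists_le_of_finite (M m)
      refine ⟨E.sup E', fun n hn => ?_⟩
      rcases Nat.lt_succ_iff_lt_or_eq.mp hn with h | rfl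
      · exact (hE n h).trans le_sup_left
      · exact hE'.trans le_sup_right
  obtain ⟨E, hE⟩ := key N
  refine ⟨E, fun n => ?_⟩
  by_cases hn : n < N
  · exact hE n hn
  · rw [(Submodule.subsingleton_iff_eq_bot).mp (h₂ n (by omega))]
    exact bot_le

/-- The image of a finite-dimensional coalgebra is enclosed in a finite-dimensional subcoalgebra;
there is no need to see that the image itself is one. -/
theorem FiniteSubcoalgebra.exists_lift {D X : CDGC k} (hD : D.X.IsFiniteDim) (g : D ⟶ X) :
    ∃ (E : FiniteSubcoalgebra X) (g' : D ⟶ E.toCDGC), g' ≫ E.incl = g := by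
  obtain ⟨E, hE⟩ := exists_le (fun n => LinearMap.range (g.f.f n).hom)
    (IsTotallyFinite.of_surjective hD (fun n => (g.f.f n).hom.rangeRestrict)
      (fun n => LinearMap.surjective_rangeRestrict _))
  exact ⟨E, E.lift g fun n x => hE n ⟨x, rfl⟩, E.lift_incl g _⟩

end CDGC

/-! ### Gluing along finite-dimensional subcoalgebras -/

namespace CDGC

variable {k : Type u} [Field k]

theorem comp_apply {C D E : CDGC k} (f : C ⟶ D) (g : D ⟶ E) (n : ℕ) (x : C.X.X n) :
    ((f ≫ g).f.f n).hom x = (g.f.f n).hom ((f.f.f n).hom x) := rfl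

namespace FiniteSubcoalgebra

variable {X Z : CDGC k}

/-- The subcoalgebras generated by single elements already cover X. -/
theorem hom_ext {f g : X ⟶ Z} (h : ∀ E : FiniteSubcoalgebra X, E.incl ≫ f = E.incl ≫ g) :
    f = g :=
  hom_ext_apply fun n x => by
    obtain ⟨y, hy⟩ := (generated x).exists_incl_eq (mem_generated x)
    rw [← hy]
    exact Hom.congr_apply (h (generated x)) n y

/-- Both subcoalgebras lie in their sum, where the two elements become equal because the inclusion
of the sum is injective. -/
theorem compatible_apply {g : ∀ E : FiniteSubcoalgebra X, E.toCDGC ⟶ Z}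
    (hg : ∀ E E' (h : ∀ n, E.S n ≤ E'.S n), inclusion h ≫ g E' = g E)
    {E E' : FiniteSubcoalgebra X} {n : ℕ} {x : E.toCDGC.X.X n} {y : E'.toCDGC.X.X n}
    (hxy : (E.incl.f.f n).hom x = (E'.incl.f.f n).hom y) :
    ((g E).f.f n).hom x = ((g E').f.f n).hom y := by
  have h₁ : ∀ m, E.S m ≤ (E.sup E').S m := fun m => le_sup_left
  have h₂ : ∀ m, E'.S m ≤ (E.sup E').S m := fun m => le_sup_right
  rw [← hg E _ h₁, ← hg E' _ h₂, comp_apply, comp_apply]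
  congr 1
  exact (E.sup E').incl_injective n hxy

/-- The value at an element of the map glued from a family of maps on the finite-dimensional
subcoalgebras. -/
def glueFun (g : ∀ E : FiniteSubcoalgebra X, E.toCDGC ⟶ Z) (n : ℕ) (x : X.X.X n) : Z.X.X n :=
  ((g (generated x)).f.f n).hom ((generated x).exists_incl_eq (mem_generated x)).choose

variable {g : ∀ E : FiniteSubcoalgebra X, E.toCDGC ⟶ Z}
  (hg : ∀ E E' (h : ∀ n, E.S n ≤ E'.S n), inclusion h ≫ g E' = g E)

/-- The glued value does not depend on the subcoalgebra used to compute it; every later property of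
the glued map is checked inside one such subcoalgebra. -/
theorem glueFun_incl (hg : ∀ E E' (h : ∀ n, E.S n ≤ E'.S n), inclusion h ≫ g E' = g E)
    (E : FiniteSubcoalgebra X) (n : ℕ) (y : E.toCDGC.X.X n) :
    glueFun g n ((E.incl.f.f n).hom y) = ((g E).f.f n).hom y :=
  compatible_apply hg (exists_incl_eq _ (mem_generated _)).choose_spec

/-- The sum of the two generated subcoalgebras contains both elements. Taking the elements equal
covers statements about a single element. -/
theorem exists_incl_eq_incl_eq {m n : ℕ} (x : X.X.X m) (y : X.X.X n) :
    ∃ (E : FiniteSubcoalgebra X) (x' : E.toCDGC.X.X m) (y' : E.toCDGC.X.X n),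
      (E.incl.f.f m).hom x' = x ∧ (E.incl.f.f n).hom y' = y := by
  obtain ⟨x', hx⟩ := ((generated x).sup (generated y)).exists_incl_eq
    (Submodule.mem_sup_left (mem_generated x))
  obtain ⟨y', hy⟩ := ((generated x).sup (generated y)).exists_incl_eq
    (Submodule.mem_sup_right (mem_generated y))
  exact ⟨_, x', y', hx, hy⟩

/-- The glued map in a fixed degree. -/
def glueLinear (n : ℕ) : X.X.X n →ₗ[k] Z.X.X n where
  toFun := glueFun g n
  map_add' x y := by
    obtain ⟨E, x, y, rfl, rfl⟩ := exists_incl_eq_incl_eq x y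
    rw [← map_add, glueFun_incl hg, glueFun_incl hg, glueFun_incl hg, map_add]
  map_smul' c x := by
    obtain ⟨E, x, -, rfl, -⟩ := exists_incl_eq_incl_eq x x
    rw [← map_smul, glueFun_incl hg, glueFun_incl hg, map_smul]
    rfl

theorem glueLinear_incl (E : FiniteSubcoalgebra X) (n : ℕ) (y : E.toCDGC.X.X n) :
    glueLinear hg n ((E.incl.f.f n).hom y) = ((g E).f.f n).hom y :=
  glueFun_incl hg E n y

theorem glueLinear_comp_incl (E : FiniteSubcoalgebra X) (n : ℕ) :
    glueLinear hg n ∘ₗ (E.incl.f.f n).hom = ((g E).f.f n).hom :=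
  LinearMap.ext (glueLinear_incl hg E n)

/-- The coalgebra map glued from a compatible family of maps on the finite-dimensional
subcoalgebras. -/
def glue : X ⟶ Z where
  f :=
    { f := fun n => ModuleCat.ofHom (glueLinear hg n)
      comm' := fun i j _ => ModuleCat.hom_ext (LinearMap.ext fun x => by
        obtain ⟨E, x, -, rfl, -⟩ := exists_incl_eq_incl_eq x x
        change (Z.X.d i j).hom (glueLinear hg i ((E.incl.f.f i).hom x)) =
          glueLinear hg j ((X.X.d i j).hom ((E.incl.f.f i).hom x))
        rw [← HomologicalComplex.hom_d_apply, glueLinear_incl, glueLinear_incl,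
          HomologicalComplex.hom_d_apply]) }
  map_comul p q n h x := by
    obtain ⟨E, x, -, rfl, -⟩ := exists_incl_eq_incl_eq x x
    change Z.comul p q n h (glueLinear hg n ((E.incl.f.f n).hom x)) =
      TensorProduct.map (glueLinear hg p) (glueLinear hg q) _
    rw [E.incl.map_comul, TensorProduct.map_map, glueLinear_comp_incl, glueLinear_comp_incl,
      glueLinear_incl, (g E).map_comul]
  map_counit x := by
    obtain ⟨E, x, -, rfl, -⟩ := exists_incl_eq_incl_eq x x
    change Z.counit (glueLinear hg 0 ((E.incl.f.f 0).hom x)) = _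
    rw [glueLinear_incl, (g E).map_counit, E.incl.map_counit]

theorem incl_glue (E : FiniteSubcoalgebra X) : E.incl ≫ glue hg = g E :=
  hom_ext_apply (glueLinear_incl hg E)

end FiniteSubcoalgebra

/-! ### Cofree coalgebras -/

/-- `t : T ⟶ V` exhibits the coalgebra `T` as cofree on the complex `V`. -/
def IsCofree {V : ChainComplex (ModuleCat.{u} k) ℕ} {T : CDGC k} (t : T.X ⟶ V) : Prop :=
  ∀ (X : CDGC k) (φ : X.X ⟶ V), ∃! f : X ⟶ T, f.f ≫ t = φ

/-- A colimit of coalgebras is cofree on `V` if maps from finite-dimensional coalgebras to `V` lift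
to its terms, uniquely in the colimit. -/
theorem isCofree_of_isColimit {V : ChainComplex (ModuleCat.{u} k) ℕ} {J : Type u}
    [Category.{u} J] {F : J ⥤ CDGC k} {c : Cocone F} (hc : IsColimit c) (t : c.pt.X ⟶ V)
    (h₁ : ∀ D : CDGC k, D.X.IsFiniteDim → ∀ φ : D.X ⟶ V,
      ∃ (j : J) (v : D ⟶ F.obj j), (v ≫ c.ι.app j).f ≫ t = φ)
    (h₂ : ∀ D : CDGC k, D.X.IsFiniteDim → ∀ (i j : J) (v : D ⟶ F.obj i) (w : D ⟶ F.obj j),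
      (v ≫ c.ι.app i).f ≫ t = (w ≫ c.ι.app j).f ≫ t → v ≫ c.ι.app i = w ≫ c.ι.app j) :
    IsCofree t := by
  choose j v hv using h₁
  -- By uniqueness in the colimit, the chosen lift can be replaced by any other lift of the same
  -- map.
  have hι : ∀ (D : CDGC k) (hD : D.X.IsFiniteDim) (φ : D.X ⟶ V) (i : J) (w : D ⟶ F.obj i),
      (w ≫ c.ι.app i).f ≫ t = φ → v D hD φ ≫ c.ι.app (j D hD φ) = w ≫ c.ι.app i :=
    fun D hD φ i w hw => h₂ D hD _ _ _ _ ((hv D hD φ).trans hw.symm)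
  -- The second clause records more than existence: restricted to any finite-dimensional D → X, the
  -- map f is the canonical lift, which depends only on the composite to V. Uniqueness is extracted
  -- from this clause.
  have ex : ∀ (X : CDGC k) (φ : X.X ⟶ V), ∃ f : X ⟶ c.pt, f.f ≫ t = φ ∧
      ∀ (D : CDGC k) (hD : D.X.IsFiniteDim) (g : D ⟶ X),
        g ≫ f = v D hD (g.f ≫ φ) ≫ c.ι.app (j D hD (g.f ≫ φ)) := by
    intro X φ
    have hg : ∀ (E E' : FiniteSubcoalgebra X) (h : ∀ n, E.S n ≤ E'.S n),
        FiniteSubcoalgebra.inclusion h ≫ v E'.toCDGC E'.isFiniteDim (E'.incl.f ≫ φ) ≫ c.ι.app _ =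
          v E.toCDGC E.isFiniteDim (E.incl.f ≫ φ) ≫ c.ι.app _ := by
      intro E E' h
      rw [← Category.assoc]
      refine (hι E.toCDGC E.isFiniteDim (E.incl.f ≫ φ) _ (FiniteSubcoalgebra.inclusion h ≫
        v E'.toCDGC E'.isFiniteDim (E'.incl.f ≫ φ)) ?_).symm
      rw [Category.assoc, comp_f, Category.assoc, hv]
      rfl
    have key : ∀ (D : CDGC k) (hD : D.X.IsFiniteDim) (g : D ⟶ X),
        g ≫ FiniteSubcoalgebra.glue hg = v D hD (g.f ≫ φ) ≫ c.ι.app (j D hD (g.f ≫ φ)) := by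
      intro D hD g
      -- A map out of a finite-dimensional coalgebra factors through a finite-dimensional
      -- subcoalgebra, where the glued map is known.
      obtain ⟨E, g', rfl⟩ := FiniteSubcoalgebra.exists_lift hD g
      rw [Category.assoc, FiniteSubcoalgebra.incl_glue, ← Category.assoc]
      refine (hι D hD _ _ (g' ≫ v E.toCDGC E.isFiniteDim (E.incl.f ≫ φ)) ?_).symm
      rw [Category.assoc, comp_f, Category.assoc, hv]
      rfl
    refine ⟨FiniteSubcoalgebra.glue hg, ?_, key⟩
    refine HomologicalComplex.hom_ext _ _ fun n => ModuleCat.hom_ext (LinearMap.ext fun x => ?_)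
    obtain ⟨E, x, -, rfl, -⟩ := FiniteSubcoalgebra.exists_incl_eq_incl_eq x x
    have e : (E.incl ≫ FiniteSubcoalgebra.glue hg).f ≫ t = E.incl.f ≫ φ := by
      rw [FiniteSubcoalgebra.incl_glue, hv]
    exact congrArg (fun s => ModuleCat.Hom.hom (HomologicalComplex.Hom.f s n) x) e
  -- Applied to the colimit itself, the construction gives an endomorphism f that replaces every map
  -- from a finite-dimensional coalgebra by its canonical lift. Once f is known to be the identity,
  -- such maps are determined by their composites with t.
  obtain ⟨f, -, hf⟩ := ex c.pt t
  have hid : f = 𝟙 c.pt := by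
    -- The terms of the diagram need not be finite-dimensional, so the comparison is made on their
    -- finite-dimensional subcoalgebras. These map to the colimit through a term, as uniqueness of
    -- lifts requires.
    refine hc.hom_ext fun i => FiniteSubcoalgebra.hom_ext fun E => ?_
    rw [Category.comp_id, ← Category.assoc, hf E.toCDGC E.isFiniteDim]
    exact hι _ _ _ _ _ rfl
  intro X φ
  obtain ⟨g, hg, -⟩ := ex X φ
  refine ⟨g, hg, fun g' hg' => FiniteSubcoalgebra.hom_ext fun E => ?_⟩
  have e₁ := hf E.toCDGC E.isFiniteDim (E.incl ≫ g)
  have e₂ := hf E.toCDGC E.isFiniteDim (E.incl ≫ g')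
  rw [hid, Category.comp_id] at e₁ e₂
  have e : (E.incl ≫ g).f ≫ t = (E.incl ≫ g').f ≫ t := by
    rw [comp_f, comp_f, Category.assoc, Category.assoc, hg, hg']
  rw [e₁, e₂, e]

/-- A cofree coalgebra on `V` is the colimit of a diagram over it such that maps from
finite-dimensional coalgebras to `V` lift to its terms, essentially uniquely. -/
theorem nonempty_isColimit_of_isCofree {V : ChainComplex (ModuleCat.{u} k) ℕ} {J : Type u}
    [Category.{u} J] {F : J ⥤ CDGC k} (c : Cocone F) {t : c.pt.X ⟶ V} (ht : IsCofree t)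
    (h₁ : ∀ D : CDGC k, D.X.IsFiniteDim → ∀ φ : D.X ⟶ V,
      ∃ (j : J) (v : D ⟶ F.obj j), v.f ≫ (c.ι.app j).f ≫ t = φ)
    (h₂ : ∀ D : CDGC k, D.X.IsFiniteDim → ∀ (i j : J) (v : D ⟶ F.obj i) (w : D ⟶ F.obj j),
      v.f ≫ (c.ι.app i).f ≫ t = w.f ≫ (c.ι.app j).f ≫ t →
        ∃ (l : J) (a : i ⟶ l) (b : j ⟶ l), v ≫ F.map a = w ≫ F.map b) :
    Nonempty (IsColimit c) := by
  have hι : ∀ j, (colimit.ι F j).f ≫ (colimit.desc F c).f ≫ t = (c.ι.app j).f ≫ t := fun j => by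
    rw [← Category.assoc, ← comp_f, colimit.ι_desc]
  -- The actual colimit is cofree as well, since maps equalised at a later stage l agree in the
  -- colimit.
  have hT : IsCofree ((colimit.desc F c).f ≫ t) := by
    refine isCofree_of_isColimit (colimit.isColimit F) _ (fun D hD φ => ?_)
      (fun D hD i j v w hvw => ?_)
    · obtain ⟨j, v, rfl⟩ := h₁ D hD φ
      refine ⟨j, v, ?_⟩
      rw [comp_f, Category.assoc]
      exact congrArg _ (hι j)
    · rw [comp_f, comp_f, Category.assoc, Category.assoc] at hvw
      obtain ⟨l, a, b, e⟩ := h₂ D hD i j v w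
        ((congrArg _ (hι i)).symm.trans (hvw.trans (congrArg _ (hι j))))
      change v ≫ colimit.ι F i = w ≫ colimit.ι F j
      rw [← colimit.w F a, ← colimit.w F b, ← Category.assoc, e, Category.assoc]
  -- Both apexes are cofree on V, so the comparison map is inverted by the map that cofreeness gives
  -- in the other direction.
  obtain ⟨f, hf, -⟩ := hT c.pt t
  have : IsIso ((colimit.isColimit F).desc c) := by
    change IsIso (colimit.desc F c)
    refine ⟨f, (hT _ _).unique (y₁ := colimit.desc F c ≫ f) ?_ (Category.id_comp _),
      (ht _ _).unique (y₁ := f ≫ colimit.desc F c) ?_ (Category.id_comp _)⟩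
    · rw [comp_f, Category.assoc, hf]
    · rw [comp_f, Category.assoc, hf]
  exact ⟨IsColimit.ofPointIso (colimit.isColimit F)⟩

end CDGC

/-! ### The algebra dual to a coalgebra -/

section Pairing

variable {k : Type*} [Field k] {M N P Q : Type*} [AddCommGroup M] [Module k M]
  [AddCommGroup N] [Module k N] [AddCommGroup P] [Module k P] [AddCommGroup Q] [Module k Q]

/-- The linear form `x ⊗ y ↦ f x * g y`. -/
def tensorForm (f : Module.Dual k M) (g : Module.Dual k N) : Module.Dual k (M ⊗[k] N) :=
  LinearMap.mul' k k ∘ₗ TensorProduct.map f g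

@[simp]
theorem tensorForm_tmul (f : Module.Dual k M) (g : Module.Dual k N) (x : M) (y : N) :
    tensorForm f g (x ⊗ₜ[k] y) = f x * g y := rfl

theorem tensorForm_add_left (f f' : Module.Dual k M) (g : Module.Dual k N) :
    tensorForm (f + f') g = tensorForm f g + tensorForm f' g :=
  TensorProduct.ext' fun x y => by simp [add_mul]

theorem tensorForm_add_right (f : Module.Dual k M) (g g' : Module.Dual k N) :
    tensorForm f (g + g') = tensorForm f g + tensorForm f g' :=
  TensorProduct.ext' fun x y => by simp [mul_add]

theorem tensorForm_smul_left (c : k) (f : Module.Dual k M) (g : Module.Dual k N) :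
    tensorForm (c • f) g = c • tensorForm f g :=
  TensorProduct.ext' fun x y => by simp [mul_assoc]

theorem tensorForm_smul_right (c : k) (f : Module.Dual k M) (g : Module.Dual k N) :
    tensorForm f (c • g) = c • tensorForm f g :=
  TensorProduct.ext' fun x y => by simp [mul_left_comm]

theorem tensorForm_comp_left (f : Module.Dual k M) (g : Module.Dual k N) (φ : P →ₗ[k] M)
    (t : P ⊗[k] N) : tensorForm (f ∘ₗ φ) g t = tensorForm f g (φ.rTensor N t) :=
  congrArg (LinearMap.mul' k k) (LinearMap.map_rTensor _ f g φ t).symm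

theorem tensorForm_comp_right (f : Module.Dual k M) (g : Module.Dual k N) (φ : P →ₗ[k] N)
    (t : M ⊗[k] P) : tensorForm f (g ∘ₗ φ) t = tensorForm f g (φ.lTensor M t) :=
  congrArg (LinearMap.mul' k k) (LinearMap.map_lTensor _ f g φ t).symm

theorem tensorForm_assoc (f : Module.Dual k M) (g : Module.Dual k N) (h : Module.Dual k P)
    (t : (M ⊗[k] N) ⊗[k] P) :
    tensorForm (tensorForm f g) h t =
      tensorForm f (tensorForm g h) (TensorProduct.assoc k M N P t) := by
  refine LinearMap.congr_fun (f := tensorForm (tensorForm f g) h)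
    (g := tensorForm f (tensorForm g h) ∘ₗ (TensorProduct.assoc k M N P).toLinearMap)
    (TensorProduct.ext_threefold fun x y z => ?_) t
  simp [mul_assoc]

theorem tensorForm_lid (f : Module.Dual k M) (g : Module.Dual k N) (t : M ⊗[k] N) :
    tensorForm f g t = g (TensorProduct.lid k N (f.rTensor N t)) := by
  induction t with
  | zero => simp
  | tmul x y => simp
  | add x y hx hy => simp only [map_add, hx, hy]

theorem tensorForm_rid (f : Module.Dual k M) (g : Module.Dual k N) (t : M ⊗[k] N) :
    tensorForm f g t = f (TensorProduct.rid k M (g.lTensor M t)) := by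
  induction t with
  | zero => simp
  | tmul x y => simp [mul_comm]
  | add x y hx hy => simp only [map_add, hx, hy]

theorem tensorForm_comm (f : Module.Dual k M) (g : Module.Dual k N) (t : M ⊗[k] N) :
    tensorForm g f (TensorProduct.comm k M N t) = tensorForm f g t := by
  induction t with
  | zero => simp
  | tmul x y => simp [mul_comm]
  | add x y hx hy => simp only [map_add, hx, hy]

/-- This is the dictionary between a map to a dual and its flip: comultiplicativity of D → (A/I)^∨
and multiplicativity of A → D^∨ express the same identity. -/
theorem dualDistrib_map_flip (ψ : P →ₗ[k] Module.Dual k M) (χ : Q →ₗ[k] Module.Dual k N)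
    (t : M ⊗[k] N) (a : P) (b : Q) :
    TensorProduct.dualDistrib k P Q (TensorProduct.map ψ.flip χ.flip t) (a ⊗ₜ b) =
      tensorForm (ψ a) (χ b) t := by
  induction t with
  | zero => simp
  | tmul x y => simp
  | add x y hx hy => simp only [map_add, LinearMap.add_apply, hx, hy]

end Pairing

namespace CDGC

variable {k : Type u} [Field k]

/-- The multiplication of the dual of a coalgebra. -/
def dualMul (X : CDGC k) (p q n : ℕ) (h : p + q = n) :
    Module.Dual k (X.X.X p) →ₗ[k] Module.Dual k (X.X.X q) →ₗ[k] Module.Dual k (X.X.X n) :=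
  LinearMap.mk₂ k (fun f g => tensorForm f g ∘ₗ X.comul p q n h)
    (fun _ _ _ => by rw [tensorForm_add_left]; rfl)
    (fun _ _ _ => by rw [tensorForm_smul_left]; rfl)
    (fun _ _ _ => by rw [tensorForm_add_right]; rfl)
    (fun _ _ _ => by rw [tensorForm_smul_right]; rfl)

theorem dualMul_apply (X : CDGC k) (p q n : ℕ) (h : p + q = n) (f : Module.Dual k (X.X.X p))
    (g : Module.Dual k (X.X.X q)) (x : X.X.X n) :
    X.dualMul p q n h f g x = tensorForm f g (X.comul p q n h x) := rfl

/-- This is the transpose of the compatibility of Δ with d. Neither the pairing of tensors nor the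
transposed differential carries a sign, so the sign (-1)^p is inherited unchanged. -/
theorem dualMul_leibniz (X : CDGC k) (p q n : ℕ) (h : p + q = n) (h₁ : (p + 1) + q = n + 1)
    (h₂ : p + (q + 1) = n + 1) (f : Module.Dual k (X.X.X p)) (g : Module.Dual k (X.X.X q)) :
    X.dualMul p q n h f g ∘ₗ (X.X.d (n + 1) n).hom =
      X.dualMul (p + 1) q (n + 1) h₁ (f ∘ₗ (X.X.d (p + 1) p).hom) g +
        (-1 : k) ^ p • X.dualMul p (q + 1) (n + 1) h₂ f (g ∘ₗ (X.X.d (q + 1) q).hom) := by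
  refine LinearMap.ext fun x => ?_
  rw [LinearMap.comp_apply, LinearMap.add_apply, LinearMap.smul_apply, dualMul_apply,
    dualMul_apply, dualMul_apply, tensorForm_comp_left, tensorForm_comp_right,
    X.comul_d p q n h h₁ h₂, map_add, map_smul]

/-- The commutative differential graded algebra dual to a coalgebra. -/
def dual (X : CDGC k) : CDGA k where
  X := X.X.linearDual
  mul := X.dualMul
  one := X.counit
  mul_assoc p q r m l n h₁ h₂ h₃ h₄ (f : Module.Dual k (X.X.X p)) (g : Module.Dual k (X.X.X q))
      (h : Module.Dual k (X.X.X r)) := by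
    refine LinearMap.ext fun x => ?_
    change tensorForm (tensorForm f g ∘ₗ X.comul p q m h₁) h (X.comul m r n h₂ x) =
      tensorForm f (tensorForm g h ∘ₗ X.comul q r l h₃) (X.comul p l n h₄ x)
    rw [tensorForm_comp_left, tensorForm_comp_right, tensorForm_assoc,
      X.coassoc p q r m l n h₁ h₂ h₃ h₄]
  one_mul n (f : Module.Dual k (X.X.X n)) := by
    refine LinearMap.ext fun x => ?_
    change tensorForm X.counit f (X.comul 0 n n _ x) = f x
    rw [tensorForm_lid, X.counit_comul]
  mul_one n (f : Module.Dual k (X.X.X n)) := by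
    refine LinearMap.ext fun x => ?_
    change tensorForm f X.counit (X.comul n 0 n _ x) = f x
    rw [tensorForm_rid, X.comul_counit]
  mul_comm p q n h h' (f : Module.Dual k (X.X.X p)) (g : Module.Dual k (X.X.X q)) := by
    refine LinearMap.ext fun x => ?_
    change tensorForm f g (X.comul p q n h x) =
      (-1 : k) ^ (p * q) • tensorForm g f (X.comul q p n h' x)
    rw [← tensorForm_comm, X.cocomm p q n h h', map_smul]
  leibniz := X.dualMul_leibniz

theorem dual_isFiniteDim {X : CDGC k} (hX : X.X.IsFiniteDim) : X.dual.X.IsFiniteDim := by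
  obtain ⟨h₁, N, h₂⟩ := isTotallyFinite_iff.mp hX
  refine isTotallyFinite_iff.mpr ⟨fun n => ?_, N, fun n hn => ?_⟩
  · have : Module.Finite k (X.X.X n) := h₁ n
    exact inferInstanceAs (Module.Finite k (Module.Dual k (X.X.X n)))
  · have : Subsingleton (X.X.X n) := h₂ n hn
    exact inferInstanceAs (Subsingleton (Module.Dual k (X.X.X n)))

end CDGC

/-! ### The universal property of the free algebra -/

namespace CDGA

variable {k : Type u} [Field k] (B : CDGA k)

/-- Left multiplication by a homogeneous element on the total space of an algebra. -/
def leftMul (p : ℕ) : B.X.X p →ₗ[k] Module.End k (⨁ n, B.X.X n) where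
  toFun b := DirectSum.toModule k ℕ _ fun q =>
    DirectSum.lof k ℕ (fun n => B.X.X n) (p + q) ∘ₗ B.mul p q (p + q) rfl b
  map_add' b b' := DirectSum.linearMap_ext _ fun q => LinearMap.ext fun c => by simp
  map_smul' r b := DirectSum.linearMap_ext _ fun q => LinearMap.ext fun c => by simp

/-- Leaving the target degree n free avoids transport along equalities of degrees. -/
theorem leftMul_lof (p q n : ℕ) (h : p + q = n) (b : B.X.X p) (c : B.X.X q) :
    B.leftMul p b (DirectSum.lof k ℕ (fun n => B.X.X n) q c) =
      DirectSum.lof k ℕ (fun n => B.X.X n) n (B.mul p q n h b c) := by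
  subst h
  exact DirectSum.toModule_lof (M := fun n => B.X.X n) k q c

/-- Associativity carries graded commutativity of B over to its left multiplications, so the action
of the tensor algebra descends to Λ W. -/
theorem leftMul_mul_leftMul (p q : ℕ) (a : B.X.X p) (b : B.X.X q) :
    B.leftMul p a * B.leftMul q b = (-1 : k) ^ (p * q) • (B.leftMul q b * B.leftMul p a) := by
  refine DirectSum.linearMap_ext _ fun r => LinearMap.ext fun c => ?_
  simp only [LinearMap.comp_apply, Module.End.mul_apply, LinearMap.smul_apply]
  rw [B.leftMul_lof q r (q + r) rfl, B.leftMul_lof p (q + r) (p + q + r) (by omega),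
    B.leftMul_lof p r (p + r) rfl, B.leftMul_lof q (p + r) (p + q + r) (by omega),
    ← B.mul_assoc p q r (p + q) (q + r) (p + q + r) rfl rfl rfl,
    ← B.mul_assoc q p r (p + q) (p + r) (p + q + r) (by omega) rfl rfl,
    B.mul_comm p q (p + q) rfl (by omega), map_smul, LinearMap.smul_apply, map_smul]

/-- The Leibniz rule for 1 · 1 reads d 1 = d 1 + d 1. -/
theorem d_one : (B.X.d 0 1).hom B.one = 0 := by
  have h := B.leibniz 0 0 0 rfl rfl rfl B.one B.one
  rwa [B.one_mul, B.mul_one, B.one_mul, pow_zero, one_smul, left_eq_add] at h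

end CDGA

namespace FreeCDGA

variable {k : Type u} [Field k] {W : CochainComplex (ModuleCat.{u} k) ℕ} {B : CDGA k}
  (φ : W ⟶ B.X)

/-- The action of `Λ W` on an algebra `B` defined by a chain map `W ⟶ B`. -/
def act : Alg W →ₐ[k] Module.End k (⨁ n, B.X.X n) :=
  RingQuot.liftAlgHom k ⟨TensorAlgebra.lift k
    (DirectSum.toModule k ℕ _ fun n => B.leftMul n ∘ₗ (φ.f n).hom), by
      rintro _ _ ⟨p, q, x, y⟩
      simpa [tgen] using B.leftMul_mul_leftMul p q ((φ.f p).hom x) ((φ.f q).hom y)⟩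

theorem act_gen (n : ℕ) (x : W.X n) : act φ (gen W n x) = B.leftMul n ((φ.f n).hom x) := by
  have h : act φ (mk W (tgen W n x)) = TensorAlgebra.lift k
      (DirectSum.toModule k ℕ _ fun n => B.leftMul n ∘ₗ (φ.f n).hom) (tgen W n x) :=
    RingQuot.liftAlgHom_mkAlgHom_apply _ _ _ _
  refine h.trans ?_
  simp [tgen]

/-- The linear map underlying the extension of a chain map `W ⟶ B` to `Λ W`. -/
def liftLinear (n : ℕ) : Alg W →ₗ[k] B.X.X n :=
  DirectSum.component k ℕ (fun n => B.X.X n) n ∘ₗ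
    LinearMap.applyₗ (DirectSum.lof k ℕ (fun n => B.X.X n) 0 B.one) ∘ₗ (act φ).toLinearMap

theorem liftLinear_apply (n : ℕ) (a : Alg W) :
    liftLinear φ n a = DirectSum.component k ℕ (fun n => B.X.X n) n
      (act φ a (DirectSum.lof k ℕ (fun n => B.X.X n) 0 B.one)) := rfl

/-- A homogeneous element acts as left multiplication by its value at the unit of B. Evaluation at
the unit is therefore multiplicative. -/
theorem act_lof {n : ℕ} {a : Alg W} (ha : a ∈ deg W n) (r m : ℕ) (h : n + r = m) (c : B.X.X r) :
    act φ a (DirectSum.lof k ℕ (fun n => B.X.X n) r c) =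
      DirectSum.lof k ℕ (fun n => B.X.X n) m (B.mul n r m h (liftLinear φ n a) c) := by
  -- The multiplier b is first built along words, and only afterwards identified by letting a act on
  -- the unit.
  have key : ∃ b : B.X.X n, ∀ (r m : ℕ) (h : n + r = m) (c : B.X.X r),
      act φ a (DirectSum.lof k ℕ (fun n => B.X.X n) r c) =
        DirectSum.lof k ℕ (fun n => B.X.X n) m (B.mul n r m h b c) := by
    clear h c r m
    induction ha using Submodule.span_induction with
    | zero => exact ⟨0, fun r m h c => by simp⟩
    | add x y _ _ hx hy =>
      obtain ⟨b, hb⟩ := hx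
      obtain ⟨b', hb'⟩ := hy
      refine ⟨b + b', fun r m h c => ?_⟩
      rw [map_add, LinearMap.add_apply, hb r m h, hb' r m h, map_add, LinearMap.add_apply, map_add]
    | smul c x _ hx =>
      obtain ⟨b, hb⟩ := hx
      refine ⟨c • b, fun r m h c => ?_⟩
      rw [map_smul, LinearMap.smul_apply, hb r m h, map_smul, LinearMap.smul_apply, map_smul]
    | mem a ha =>
      have ha' : IsWord W n a := ha
      clear ha
      induction ha' with
      | one =>
        refine ⟨B.one, fun r m h c => ?_⟩
        obtain rfl : r = m := by omega
        rw [map_one, B.one_mul]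
        rfl
      | cons p q n hn x a _ ih =>
        obtain ⟨b, hb⟩ := ih
        refine ⟨B.mul p q n hn ((φ.f p).hom x) b, fun r m h c => ?_⟩
        rw [map_mul, Module.End.mul_apply, hb r (q + r) rfl, act_gen,
          B.leftMul_lof p (q + r) m (by omega), B.mul_assoc p q r n (q + r) m hn h rfl]
  obtain ⟨b, hb⟩ := key
  have e : liftLinear φ n a = b := by
    rw [liftLinear_apply, hb 0 n (Nat.add_zero n), B.mul_one, DirectSum.component.lof_self]
  rw [e, hb r m h]

theorem liftLinear_mul {p q n : ℕ} (h : p + q = n) {a b : Alg W} (ha : a ∈ deg W p)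
    (hb : b ∈ deg W q) :
    liftLinear φ n (a * b) = B.mul p q n h (liftLinear φ p a) (liftLinear φ q b) := by
  rw [liftLinear_apply, map_mul, Module.End.mul_apply, act_lof φ hb 0 q rfl, B.mul_one,
    act_lof φ ha q n h, DirectSum.component.lof_self]

theorem liftLinear_one : liftLinear φ 0 (1 : Alg W) = B.one := by
  rw [liftLinear_apply, map_one]
  exact DirectSum.component.lof_self (M := fun n => B.X.X n) k 0 B.one

theorem liftLinear_gen (n : ℕ) (x : W.X n) : liftLinear φ n (gen W n x) = (φ.f n).hom x := by
  rw [liftLinear_apply, act_gen, B.leftMul_lof n 0 n rfl, B.mul_one, DirectSum.component.lof_self]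

/-- Both differentials satisfy the Leibniz rule and agree on generators because φ is a chain map;
induction on words does the rest. -/
theorem liftLinear_diff {n : ℕ} {a : Alg W} (ha : a ∈ deg W n) :
    liftLinear φ (n + 1) (diff W a) = (B.X.d n (n + 1)).hom (liftLinear φ n a) := by
  induction ha using Submodule.span_induction with
  | zero => simp
  | add x y _ _ hx hy => rw [map_add, map_add, map_add, map_add, hx, hy]
  | smul c x _ hx => rw [map_smul, map_smul, map_smul, map_smul, hx]
  | mem a ha =>
    have ha' : IsWord W n a := ha
    clear ha
    induction ha' with
    | one => rw [diff_one, map_zero, liftLinear_one, B.d_one]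
    | cons p q n hn x a ha ih =>
      have ha' : a ∈ deg W q := Submodule.subset_span ha
      rw [diff_mul (gen_mem_deg p x), diff_gen, map_add, map_smul,
        liftLinear_mul φ (p := p + 1) (q := q) (by omega) (gen_mem_deg _ _) ha',
        liftLinear_mul φ (p := p) (q := q + 1) (by omega) (gen_mem_deg _ _) (diff_mem_deg ha'),
        liftLinear_mul φ hn (gen_mem_deg _ _) ha', liftLinear_gen, liftLinear_gen, ih,
        B.leibniz p q n hn (by omega) (by omega), HomologicalComplex.hom_d_apply φ]

/-- The extension of a chain map `W ⟶ B` to `Λ W`, in a fixed degree. -/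
def lift (n : ℕ) : (freeCDGA W).X.X n →ₗ[k] B.X.X n := liftLinear φ n ∘ₗ (deg W n).subtype

theorem lift_mul (p q n : ℕ) (h : p + q = n) (a : (freeCDGA W).X.X p) (b : (freeCDGA W).X.X q) :
    lift φ n ((freeCDGA W).mul p q n h a b) = B.mul p q n h (lift φ p a) (lift φ q b) :=
  liftLinear_mul φ h a.2 b.2

theorem lift_one : lift φ 0 (freeCDGA W).one = B.one := liftLinear_one φ

theorem lift_unit (n : ℕ) (x : W.X n) :
    lift φ n (((freeCDGAUnit W).f n).hom x) = (φ.f n).hom x :=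
  liftLinear_gen φ n x

theorem lift_d (i j : ℕ) (a : (freeCDGA W).X.X i) :
    lift φ j (((freeCDGA W).X.d i j).hom a) = (B.X.d i j).hom (lift φ i a) := by
  by_cases h : i + 1 = j
  · subst h
    have e : (freeCDGA W).X.d i (i + 1) = ModuleCat.ofHom (freeDiff W i) := freeComplex_d W i
    rw [e]
    exact liftLinear_diff φ a.2
  · rw [(freeCDGA W).X.shape i j h, B.X.shape i j h]
    exact map_zero _

/-- The kernel of the extension of a chain map `W ⟶ B` to `Λ W`, for finite-dimensional `B`. -/
def liftKer (hB : B.X.IsFiniteDim) : CDGA.CofiniteIdeal (freeCDGA W) where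
  I n := LinearMap.ker (lift φ n)
  mul_mem p q n h a b hb := by
    rw [LinearMap.mem_ker] at hb ⊢
    rw [lift_mul, hb, map_zero]
  d_mem i j a ha := by
    rw [LinearMap.mem_ker] at ha ⊢
    rw [lift_d, ha, map_zero]
  -- The quotient by the kernel embeds in B.
  finite := IsTotallyFinite.of_injective hB
    (fun n => (LinearMap.ker (lift φ n)).liftQ (lift φ n) le_rfl)
    (fun n => LinearMap.ker_eq_bot.mp (Submodule.ker_liftQ_eq_bot _ _ _ le_rfl))

end FreeCDGA

/-! ### Directedness of the diagrams -/

namespace CDGA.CofiniteIdeal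

variable {k : Type u} [Field k] {A : CDGA k}

/-- The intersection of two differential ideals of finite codimension. -/
def inf (I J : CofiniteIdeal A) : CofiniteIdeal A where
  I n := I.I n ⊓ J.I n
  mul_mem p q n h a b hb := ⟨I.mul_mem p q n h a b hb.1, J.mul_mem p q n h a b hb.2⟩
  d_mem i j a ha := ⟨I.d_mem i j a ha.1, J.d_mem i j a ha.2⟩
  -- The quotient by the intersection embeds in the product of the two quotients.
  finite := IsTotallyFinite.of_injective (I.finite.prod J.finite)
    (fun n => (I.I n ⊓ J.I n).liftQ ((I.I n).mkQ.prod (J.I n).mkQ) (by simp [LinearMap.ker_prod]))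
    (fun n => LinearMap.ker_eq_bot.mp (Submodule.ker_liftQ_eq_bot _ _ _
      (by simp [LinearMap.ker_prod])))

theorem inf_le_left (I J : CofiniteIdeal A) : I.inf J ≤ I := fun _ => _root_.inf_le_left

theorem inf_le_right (I J : CofiniteIdeal A) : I.inf J ≤ J := fun _ => _root_.inf_le_right

/-- The unit ideal. -/
def top (A : CDGA k) : CofiniteIdeal A where
  I n := ⊤
  mul_mem _ _ _ _ _ _ _ := Submodule.mem_top
  d_mem _ _ _ _ := Submodule.mem_top
  finite := isTotallyFinite_iff.mpr ⟨fun _ => inferInstance, 0, fun _ _ => inferInstance⟩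

instance : Nonempty (CofiniteIdeal A) := ⟨top A⟩

instance : IsCodirectedOrder (CofiniteIdeal A) :=
  ⟨fun I J => ⟨I.inf J, inf_le_left I J, inf_le_right I J⟩⟩

end CDGA.CofiniteIdeal

/-! ### Lifting a chain map to a dual quotient -/

namespace CDGC

variable {k : Type u} [Field k] {V : ChainComplex (ModuleCat.{u} k) ℕ} {D : CDGC k}

/-- The transpose `V^∨ ⟶ D^∨` of a chain map `D ⟶ V`. -/
def transpose (φ : D.X ⟶ V) : V.linearDual ⟶ D.dual.X where
  f n := ModuleCat.ofHom (φ.f n).hom.dualMap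
  comm' i j _ := ModuleCat.hom_ext (LinearMap.ext fun (g : Module.Dual k (V.X i)) =>
    LinearMap.ext fun x => congrArg g (HomologicalComplex.hom_d_apply φ j i x))

/-- The coalgebra map `D ⟶ (Λ V^∨ / I)^∨` defined by a chain map `D ⟶ V`, where `I` is the kernel
of the induced map `Λ V^∨ ⟶ D^∨`. -/
def toDualQuotient (φ : D.X ⟶ V) (hD : D.X.IsFiniteDim) :
    D ⟶ (FreeCDGA.liftKer (transpose φ) (dual_isFiniteDim hD)).quotient.dual where
  f :=
    -- The map Λ V^∨ / I → D^∨ is a pairing of Λ V^∨ / I with D; flipping it gives D → (Λ V^∨ /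
    -- I)^∨.
    { f := fun n => ModuleCat.ofHom
        (((LinearMap.ker (FreeCDGA.lift (transpose φ) n)).liftQ
          (FreeCDGA.lift (transpose φ) n) le_rfl).flip)
      comm' := fun i j _ => ModuleCat.hom_ext (LinearMap.ext fun x => by
        refine Submodule.linearMap_qext _ (LinearMap.ext fun a => ?_)
        exact LinearMap.congr_fun (FreeCDGA.lift_d (transpose φ) j i a) x) }
  map_comul p q n h x := by
    refine CDGA.dualDistrib_ext fun a b => ?_
    refine (CDGA.dualDistrib_dualComul _ p q n h _ a b).trans ?_
    refine Eq.trans ?_ (dualDistrib_map_flip _ _ (D.comul p q n h x) a b).symm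
    induction a using Submodule.Quotient.induction_on with | _ a
    induction b using Submodule.Quotient.induction_on with | _ b
    exact LinearMap.congr_fun (FreeCDGA.lift_mul (transpose φ) p q n h a b) x
  map_counit x := LinearMap.congr_fun (FreeCDGA.lift_one (transpose φ)) x

/-- Tested against a form g on V, the composite evaluates the extension Λ V^∨ → D^∨ at the generator
g, where it is the transpose of φ. -/
theorem toDualQuotient_comp (φ : D.X ⟶ V) (hD : D.X.IsFiniteDim) (hV : V.IsFiniteDim) :
    (toDualQuotient φ hD).f ≫ dualQuotientToComplex V hV _ = φ := by
  have := fun n => hV.finite n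
  refine HomologicalComplex.hom_ext _ _ fun n => ModuleCat.hom_ext (LinearMap.ext fun x => ?_)
  apply (Module.evalEquiv k (V.X n)).injective
  refine LinearMap.ext fun g => ?_
  change g ((Module.evalEquiv k (V.X n)).symm _) = g ((φ.f n).hom x)
  rw [Module.apply_evalEquiv_symm_apply]
  refine Eq.trans ?_ (LinearMap.congr_fun (FreeCDGA.lift_unit (transpose φ) n g) x)
  rfl

theorem dualQuotientToComplex_apply (hV : V.IsFiniteDim)
    (J : CDGA.CofiniteIdeal (freeCDGA V.linearDual)) (n : ℕ) 
    (f : Module.Dual k (J.quotient.X.X n)) (g : Module.Dual k (V.X n)) :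
    g (((dualQuotientToComplex V hV J).f n).hom f) =
      f (Submodule.Quotient.mk
        (((freeCDGAUnit V.linearDual).f n).hom g)) := by
  have := fun n => hV.finite n
  change g ((Module.evalEquiv k (V.X n)).symm _) = _
  rw [Module.apply_evalEquiv_symm_apply]
  rfl

end CDGC

namespace CDGC

variable {k : Type u} [Field k]

/-! ### Uniqueness of lifts to the dual quotients -/

section DualQuotient

variable {A : CDGA k} {D : CDGC k}

/-- The map `A ⟶ D^∨` corresponding to a coalgebra map `D ⟶ (A / I)^∨`. -/
def evalQuotient {I : CDGA.CofiniteIdeal A} (v : D ⟶ I.quotient.dual) (n : ℕ) :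
    A.X.X n →ₗ[k] Module.Dual k (D.X.X n) :=
  LinearMap.flip (show D.X.X n →ₗ[k] Module.Dual k (I.quotient.X.X n) from (v.f.f n).hom) ∘ₗ
    (I.I n).mkQ

/-- Multiplicativity is the comultiplicativity of v, read through the pairing of D with A. -/
theorem evalQuotient_mul {I : CDGA.CofiniteIdeal A} (v : D ⟶ I.quotient.dual) (p q n : ℕ)
    (h : p + q = n) (a : A.X.X p) (b : A.X.X q) :
    evalQuotient v n (A.mul p q n h a b) =
      D.dualMul p q n h (evalQuotient v p a) (evalQuotient v q b) := by
  refine LinearMap.ext fun x => ?_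
  refine (CDGA.dualDistrib_dualComul I.quotient p q n h ((v.f.f n).hom x)
    (Submodule.Quotient.mk a) (Submodule.Quotient.mk b)).symm.trans ?_
  refine (congrArg (fun t => TensorProduct.dualDistrib k (I.quotient.X.X p) (I.quotient.X.X q) t
    (Submodule.Quotient.mk a ⊗ₜ Submodule.Quotient.mk b)) (v.map_comul p q n h x)).trans ?_
  exact dualDistrib_map_flip
    (LinearMap.flip (show D.X.X p →ₗ[k] Module.Dual k (I.quotient.X.X p) from (v.f.f p).hom))
    (LinearMap.flip (show D.X.X q →ₗ[k] Module.Dual k (I.quotient.X.X q) from (v.f.f q).hom))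
    (D.comul p q n h x) _ _

theorem evalQuotient_one {I : CDGA.CofiniteIdeal A} (v : D ⟶ I.quotient.dual) :
    evalQuotient v 0 A.one = D.counit :=
  LinearMap.ext fun x => v.map_counit x

/-- A form on A / (I ∩ J) is determined by its values on A, so equality of the maps A → D^∨ becomes
equality of coalgebra maps once both targets are carried to I ∩ J. -/
theorem comp_dualQuotients_map_eq {I J : CDGA.CofiniteIdeal A} (v : D ⟶ I.quotient.dual)
    (w : D ⟶ J.quotient.dual) (h : ∀ n, evalQuotient v n = evalQuotient w n) :
    v ≫ (CDGA.dualQuotients A).map (homOfLE (CDGA.CofiniteIdeal.inf_le_left I J)).op =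
      w ≫ (CDGA.dualQuotients A).map (homOfLE (CDGA.CofiniteIdeal.inf_le_right I J)).op := by
  refine hom_ext_apply fun n x => ?_
  refine Submodule.linearMap_qext _ (LinearMap.ext fun a => ?_)
  exact LinearMap.congr_fun (LinearMap.congr_fun (h n) a) x

/-- The composite to V records exactly the values on generators, and a unital multiplicative map out
of Λ V^∨ is determined by these. -/
theorem evalQuotient_free_eq {V : ChainComplex (ModuleCat.{u} k) ℕ} (hV : V.IsFiniteDim)
    {I J : CDGA.CofiniteIdeal (freeCDGA V.linearDual)} (v : D ⟶ I.quotient.dual)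
    (w : D ⟶ J.quotient.dual)
    (h : v.f ≫ dualQuotientToComplex V hV I = w.f ≫ dualQuotientToComplex V hV J) (n : ℕ) :
    evalQuotient v n = evalQuotient w n := by
  have hgen : ∀ (p : ℕ) (g : V.linearDual.X p),
      evalQuotient v p (((freeCDGAUnit V.linearDual).f p).hom g) =
        evalQuotient w p (((freeCDGAUnit V.linearDual).f p).hom g) := by
    intro p (g : Module.Dual k (V.X p))
    refine LinearMap.ext fun x => ?_
    refine (dualQuotientToComplex_apply hV I p _ g).symm.trans
      (Eq.trans ?_ (dualQuotientToComplex_apply hV J p _ g))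
    exact congrArg (fun s : D.X ⟶ V => g ((s.f p).hom x)) h
  have key : ∀ (a : FreeCDGA.Alg V.linearDual) (ha : a ∈ FreeCDGA.deg V.linearDual n),
      evalQuotient v n (⟨a, ha⟩ : FreeCDGA.deg V.linearDual n) =
        evalQuotient w n (⟨a, ha⟩ : FreeCDGA.deg V.linearDual n) := by
    intro a ha
    induction ha using Submodule.span_induction with
    | zero => exact (map_zero (evalQuotient v n)).trans (map_zero (evalQuotient w n)).symm
    | add x y hx' hy' hx hy =>
      exact (map_add (evalQuotient v n) _ _).trans
        ((congrArg₂ _ hx hy).trans (map_add (evalQuotient w n) _ _).symm)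
    | smul c x hx' hx =>
      exact (map_smul (evalQuotient v n) _ _).trans
        ((congrArg _ hx).trans (map_smul (evalQuotient w n) _ _).symm)
    | mem a ha =>
      have ha' : FreeCDGA.IsWord V.linearDual n a := ha
      induction ha' with
      | one => exact (evalQuotient_one v).trans (evalQuotient_one w).symm
      | cons p q n hn x a ha' ih =>
        refine (evalQuotient_mul v p q n hn (((freeCDGAUnit V.linearDual).f p).hom x)
          (⟨a, Submodule.subset_span ha'⟩ : FreeCDGA.deg V.linearDual q)).trans
          (Eq.trans ?_ (evalQuotient_mul w p q n hn (((freeCDGAUnit V.linearDual).f p).hom x)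
            (⟨a, Submodule.subset_span ha'⟩ : FreeCDGA.deg V.linearDual q)).symm)
        rw [hgen, ih ha']
  exact LinearMap.ext fun a => key a.1 a.2

end DualQuotient

/-- The canonical chain maps `(Λ V^∨ / I)^∨ ⟶ V` are compatible. -/
def dualQuotientsToComplex {V : ChainComplex (ModuleCat.{u} k) ℕ} (hV : V.IsFiniteDim) :
    Cocone (CDGA.dualQuotients (freeCDGA V.linearDual) ⋙ forget k) where
  pt := V
  ι :=
    { app := fun J => dualQuotientToComplex V hV J.unop
      naturality := fun _ _ _ => rfl }

/-- The colimit of the dual quotients satisfies the criterion: the kernel of Λ V^∨ → D^∨ supplies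
the lift, and the intersection of two ideals compares two lifts. -/
theorem exists_isCofree_of_isFiniteDim {V : ChainComplex (ModuleCat.{u} k) ℕ}
    (hV : V.IsFiniteDim) : ∃ (T : CDGC k) (t : T.X ⟶ V), IsCofree t := by
  let F := CDGA.dualQuotients (freeCDGA V.linearDual)
  have hc := colimit.isColimit F
  let t : (colimit F).X ⟶ V :=
    (isColimitOfPreserves (forget k) hc).desc (dualQuotientsToComplex hV)
  have ht : ∀ j, (colimit.ι F j).f ≫ t = dualQuotientToComplex V hV j.unop :=
    (isColimitOfPreserves (forget k) hc).fac (dualQuotientsToComplex hV)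
  refine ⟨colimit F, t, isCofree_of_isColimit hc t (fun D hD φ => ?_)
    (fun D hD i j v w hvw => ?_)⟩
  · refine ⟨op _, toDualQuotient φ hD, ?_⟩
    exact (Category.assoc _ _ _).trans
      ((congrArg _ (ht _)).trans (toDualQuotient_comp φ hD hV))
  · change (v.f ≫ (colimit.ι F i).f) ≫ t = (w.f ≫ (colimit.ι F j).f) ≫ t at hvw
    rw [Category.assoc, Category.assoc, ht, ht] at hvw
    have e := comp_dualQuotients_map_eq v w (evalQuotient_free_eq hV v w hvw)
    change v ≫ colimit.ι F i = w ≫ colimit.ι F j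
    rw [← colimit.w F (homOfLE (CDGA.CofiniteIdeal.inf_le_left i.unop j.unop)).op,
      ← colimit.w F (homOfLE (CDGA.CofiniteIdeal.inf_le_right i.unop j.unop)).op]
    exact (Category.assoc _ _ _).symm.trans ((congrArg (· ≫ _) e).trans (Category.assoc _ _ _))

end CDGC

/-! ### Finite-dimensional subcomplexes -/

namespace FiniteSubcomplex

variable {k : Type u} [Field k] {V : ChainComplex (ModuleCat.{u} k) ℕ}

/-- The sum of two finite-dimensional subcomplexes. -/
def sup (S T : FiniteSubcomplex V) : FiniteSubcomplex V where
  S n := S.S n ⊔ T.S n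
  d_mem i j x hx := by
    obtain ⟨a, ha, b, hb, rfl⟩ := Submodule.mem_sup.mp hx
    rw [map_add]
    exact add_mem (Submodule.mem_sup_left (S.d_mem i j a ha))
      (Submodule.mem_sup_right (T.d_mem i j b hb))
  finite := S.finite.sup T.finite

theorem le_sup_left (S T : FiniteSubcomplex V) : S ≤ S.sup T := fun _ => _root_.le_sup_left

theorem le_sup_right (S T : FiniteSubcomplex V) : T ≤ S.sup T := fun _ => _root_.le_sup_right

instance : Nonempty (FiniteSubcomplex V) :=
  ⟨{ S := fun _ => ⊥
     d_mem := fun i j x hx => by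
      rw [(Submodule.mem_bot k).mp hx, map_zero]
      exact zero_mem _
     finite := isTotallyFinite_bot }⟩

instance : IsDirectedOrder (FiniteSubcomplex V) :=
  ⟨fun S T => ⟨S.sup T, le_sup_left S T, le_sup_right S T⟩⟩

/-- The image of a chain map out of a finite-dimensional complex. -/
def range {D : ChainComplex (ModuleCat.{u} k) ℕ} (hD : D.IsFiniteDim) (φ : D ⟶ V) :
    FiniteSubcomplex V where
  S n := LinearMap.range (φ.f n).hom
  d_mem := by
    rintro i j _ ⟨x, rfl⟩
    exact ⟨(D.d i j).hom x, HomologicalComplex.hom_d_apply φ i j x⟩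
  finite := IsTotallyFinite.of_surjective hD (fun n => (φ.f n).hom.rangeRestrict)
      (fun n => LinearMap.surjective_rangeRestrict _)

/-- The corestriction of a chain map to its image. -/
def toRange {D : ChainComplex (ModuleCat.{u} k) ℕ} (hD : D.IsFiniteDim) (φ : D ⟶ V) :
    D ⟶ (diagram V).obj (range hD φ) where
  f n := ModuleCat.ofHom (φ.f n).hom.rangeRestrict
  comm' i j _ := ModuleCat.hom_ext (LinearMap.ext fun x =>
    Subtype.ext (p := (· ∈ LinearMap.range (φ.f j).hom))
      (HomologicalComplex.hom_d_apply φ i j x).symm)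

theorem toRange_comp {D : ChainComplex (ModuleCat.{u} k) ℕ} (hD : D.IsFiniteDim) (φ : D ⟶ V) :
    toRange hD φ ≫ (cocone V).ι.app (range hD φ) = φ := rfl

theorem cocone_ι_cancel {D : ChainComplex (ModuleCat.{u} k) ℕ} (S : FiniteSubcomplex V)
    {φ ψ : D ⟶ (diagram V).obj S} (h : φ ≫ (cocone V).ι.app S = ψ ≫ (cocone V).ι.app S) :
    φ = ψ := by
  refine HomologicalComplex.hom_ext _ _ fun n => ModuleCat.hom_ext (LinearMap.ext fun x => ?_)
  exact (S.S n).injective_subtype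
    (congrArg (fun s => ModuleCat.Hom.hom (HomologicalComplex.Hom.f s n) x) h)

/-! ### Diagrams of cofree coalgebras on the finite-dimensional subcomplexes -/

variable {F : FiniteSubcomplex V ⥤ CDGC k} {τ : F ⋙ CDGC.forget k ⟶ diagram V}

/-- A map from D first corestricts to its image, a finite-dimensional subcomplex, and then lifts by
cofreeness there. -/
theorem exists_lift (hτ : ∀ S, CDGC.IsCofree (T := F.obj S) (τ.app S)) {D : CDGC k}
    (hD : D.X.IsFiniteDim) (φ : D.X ⟶ V) :
    ∃ (S : FiniteSubcomplex V) (v : D ⟶ F.obj S), v.f ≫ τ.app S ≫ (cocone V).ι.app S = φ := by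
  obtain ⟨v, hv, -⟩ := hτ (range hD φ) D (toRange hD φ)
  refine ⟨range hD φ, v, ?_⟩
  refine (Category.assoc _ _ _).symm.trans ?_
  rw [hv, toRange_comp]

/-- Over S + T both maps have target the same cofree coalgebra, and they induce the same chain map
to S + T because the inclusion into V is injective. -/
theorem comp_map_eq (hτ : ∀ S, CDGC.IsCofree (T := F.obj S) (τ.app S)) {D : CDGC k}
    {S T : FiniteSubcomplex V} (v : D ⟶ F.obj S) (w : D ⟶ F.obj T)
    (h : v.f ≫ τ.app S ≫ (cocone V).ι.app S = w.f ≫ τ.app T ≫ (cocone V).ι.app T) :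
    v ≫ F.map (homOfLE (le_sup_left S T)) = w ≫ F.map (homOfLE (le_sup_right S T)) := by
  have key : ∀ (S' : FiniteSubcomplex V) (a : S' ⟶ S.sup T) (v : D ⟶ F.obj S'),
      ((v ≫ F.map a).f ≫ τ.app (S.sup T)) ≫ (cocone V).ι.app (S.sup T) =
        v.f ≫ τ.app S' ≫ (cocone V).ι.app S' := by
    intro S' a v
    have e₁ : (F.map a).f ≫ τ.app (S.sup T) = τ.app S' ≫ (diagram V).map a := τ.naturality a
    have e₂ := (cocone V).w a
    refine (Category.assoc _ _ _).trans ((Category.assoc _ _ _).trans (congrArg (v.f ≫ ·) ?_))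
    exact (Category.assoc _ _ _).symm.trans ((congrArg (· ≫ _) e₁).trans
      ((Category.assoc _ _ _).trans (congrArg _ e₂)))
  refine (hτ (S.sup T) _ _).unique rfl (cocone_ι_cancel _ ?_)
  rw [key, key, h]

end FiniteSubcomplex

/-! ### The adjunction -/

namespace CDGC

variable {k : Type u} [Field k]

/-- Cofree coalgebras on the finite-dimensional subcomplexes are assembled into a diagram, whose
colimit satisfies the cofreeness criterion. -/
theorem exists_isCofree (V : ChainComplex (ModuleCat.{u} k) ℕ) :
    ∃ (T : CDGC k) (t : T.X ⟶ V), IsCofree t := by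
  choose T t ht using fun S : FiniteSubcomplex V =>
    exists_isCofree_of_isFiniteDim (V := (FiniteSubcomplex.diagram V).obj S) S.finite
  choose m hm hm' using fun (S S' : FiniteSubcomplex V) (a : S ⟶ S') =>
    ht S' (T S) (t S ≫ (FiniteSubcomplex.diagram V).map a)
  -- The coalgebras were chosen independently of each other; uniqueness of lifts makes the
  -- transition maps functorial.
  let F : FiniteSubcomplex V ⥤ CDGC k :=
    { obj := T
      map := fun {S S'} a => m S S' a
      map_id := fun S => (hm' S S (𝟙 S) (𝟙 _) rfl).symm
      map_comp := fun {S S' S''} a b => (hm' S S'' (a ≫ b) (m S S' a ≫ m S' S'' b) (by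
        change ((m S S' a).f ≫ (m S' S'' b).f) ≫ t S'' = _
        rw [Category.assoc, hm, ← Category.assoc, hm, Category.assoc, Functor.map_comp])).symm }
  let τ : F ⋙ forget k ⟶ FiniteSubcomplex.diagram V :=
    { app := t
      naturality := hm }
  have hc := colimit.isColimit F
  let s : Cocone (F ⋙ forget k) := (Cocone.precompose τ).obj (FiniteSubcomplex.cocone V)
  let t' : (colimit F).X ⟶ V := (isColimitOfPreserves (forget k) hc).desc s
  have ht' : ∀ j, (colimit.ι F j).f ≫ t' = τ.app j ≫ (FiniteSubcomplex.cocone V).ι.app j :=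
    (isColimitOfPreserves (forget k) hc).fac s
  refine ⟨colimit F, t', isCofree_of_isColimit hc t' (fun D hD φ => ?_)
    (fun D hD i j v w hvw => ?_)⟩
  · obtain ⟨S, v, hv⟩ := FiniteSubcomplex.exists_lift (τ := τ) ht hD φ
    exact ⟨S, v, (Category.assoc _ _ _).trans ((congrArg _ (ht' S)).trans hv)⟩
  · change (v.f ≫ (colimit.ι F i).f) ≫ t' = (w.f ≫ (colimit.ι F j).f) ≫ t' at hvw
    rw [Category.assoc, Category.assoc, ht', ht'] at hvw
    have e := FiniteSubcomplex.comp_map_eq (τ := τ) ht v w hvw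
    change v ≫ colimit.ι F i = w ≫ colimit.ι F j
    rw [← colimit.w F (homOfLE (FiniteSubcomplex.le_sup_left i j)),
      ← colimit.w F (homOfLE (FiniteSubcomplex.le_sup_right i j)), ← Category.assoc, e,
      Category.assoc]

/-- A cofree coalgebra on V is a terminal object in the category of coalgebras over V, and such
terminal objects for all V give a right adjoint. -/
instance : (forget k).IsLeftAdjoint := by
  refine isLeftAdjoint_iff_hasTerminal_costructuredArrow.mpr fun V => ?_
  obtain ⟨T, t, ht⟩ := exists_isCofree V
  refine IsTerminal.hasTerminal (X := CostructuredArrow.mk (S := forget k) t) ?_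
  refine IsTerminal.ofUniqueHom
    (fun Y => CostructuredArrow.homMk (ht Y.left Y.hom).choose (ht Y.left Y.hom).choose_spec.1)
    fun Y f => CostructuredArrow.hom_ext _ _ ?_
  exact (ht Y.left Y.hom).choose_spec.2 _ (CostructuredArrow.w f)

theorem isCofree_counit {C : ChainComplex (ModuleCat.{u} k) ℕ ⥤ CDGC k} (adj : forget k ⊣ C)
    (V : ChainComplex (ModuleCat.{u} k) ℕ) : IsCofree (T := C.obj V) (adj.counit.app V) := by
  intro X φ
  have key : ∀ f : X ⟶ C.obj V, f.f ≫ adj.counit.app V = (adj.homEquiv X V).symm f :=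
    fun f => (adj.homEquiv_counit (X := X) (g := f)).symm
  refine ⟨adj.homEquiv X V φ, (key _).trans ((adj.homEquiv X V).symm_apply_apply φ), ?_⟩
  intro f hf
  rw [← hf]
  exact ((adj.homEquiv X V).apply_symm_apply f).symm.trans (congrArg _ (key f).symm)

theorem nonempty_isColimit_dualQuotientsCocone
    {C : ChainComplex (ModuleCat.{u} k) ℕ ⥤ CDGC k} (adj : forget k ⊣ C)
    {V : ChainComplex (ModuleCat.{u} k) ℕ} (hV : V.IsFiniteDim) :
    Nonempty (IsColimit (dualQuotientsCocone V adj hV)) := by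
  -- By adjointness, the legs of the cocone followed by the counit are the canonical maps to V, so
  -- the lifting statements for these maps apply.
  have ht : ∀ J, ((dualQuotientsCocone V adj hV).ι.app J).f ≫ adj.counit.app V =
      dualQuotientToComplex V hV J.unop := fun J =>
    (adj.homEquiv_counit (g := (dualQuotientsCocone V adj hV).ι.app J)).symm.trans
      ((adj.homEquiv _ V).symm_apply_apply _)
  refine nonempty_isColimit_of_isCofree _ (isCofree_counit adj V) (fun D hD φ => ?_)
    (fun D hD i j v w hvw => ?_)
  · exact ⟨op _, toDualQuotient φ hD, (congrArg _ (ht _)).trans (toDualQuotient_comp φ hD hV)⟩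
  · exact ⟨_, _, _, comp_dualQuotients_map_eq v w (evalQuotient_free_eq hV v w
      ((congrArg _ (ht i)).symm.trans (hvw.trans (congrArg _ (ht j)))))⟩

theorem nonempty_isColimit_mapCocone_finiteSubcomplex
    {C : ChainComplex (ModuleCat.{u} k) ℕ ⥤ CDGC k} (adj : forget k ⊣ C)
    (V : ChainComplex (ModuleCat.{u} k) ℕ) :
    Nonempty (IsColimit (C.mapCocone (FiniteSubcomplex.cocone V))) := by
  let τ : (FiniteSubcomplex.diagram V ⋙ C) ⋙ forget k ⟶ FiniteSubcomplex.diagram V :=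
    Functor.whiskerLeft (FiniteSubcomplex.diagram V) adj.counit
  have hτ : ∀ S, IsCofree (T := (FiniteSubcomplex.diagram V ⋙ C).obj S) (τ.app S) :=
    fun S => isCofree_counit adj _
  -- Naturality of the counit turns the leg over S into the cofree projection onto S followed by the
  -- inclusion S → V.
  have ht : ∀ S, ((C.mapCocone (FiniteSubcomplex.cocone V)).ι.app S).f ≫ adj.counit.app V =
      τ.app S ≫ (FiniteSubcomplex.cocone V).ι.app S := fun S =>
    adj.counit.naturality ((FiniteSubcomplex.cocone V).ι.app S)
  refine nonempty_isColimit_of_isCofree _ (isCofree_counit adj V) (fun D hD φ => ?_)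
    (fun D hD i j v w hvw => ?_)
  · obtain ⟨S, v, hv⟩ := FiniteSubcomplex.exists_lift hτ hD φ
    exact ⟨S, v, (congrArg _ (ht S)).trans hv⟩
  · exact ⟨_, _, _, FiniteSubcomplex.comp_map_eq hτ v w
      ((congrArg _ (ht i)).symm.trans (hvw.trans (congrArg _ (ht j))))⟩

end CDGC

theorem mainTheorem5 (k : Type u) [Field k] :
    ∃ (C : ChainComplex (ModuleCat.{u} k) ℕ ⥤ CDGC k) (adj : CDGC.forget k ⊣ C),
      (∀ (V : ChainComplex (ModuleCat.{u} k) ℕ) (hV : V.IsFiniteDim),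
        IsFiltered (CDGA.CofiniteIdeal (freeCDGA V.linearDual))ᵒᵖ ∧
          Nonempty (IsColimit (dualQuotientsCocone V adj hV))) ∧
      (∀ V : ChainComplex (ModuleCat.{u} k) ℕ,
        IsFiltered (FiniteSubcomplex V) ∧
          Nonempty (IsColimit (C.mapCocone (FiniteSubcomplex.cocone V)))) := by
  -- Both descriptions hold for any right adjoint, so an arbitrary one may be taken.
  exact ⟨(CDGC.forget k).rightAdjoint, Adjunction.ofIsLeftAdjoint _,
    fun V hV => ⟨inferInstance, CDGC.nonempty_isColimit_dualQuotientsCocone (Adjunction.ofIsLeftAdjoint _) hV⟩,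
    fun V => ⟨inferInstance, CDGC.nonempty_isColimit_mapCocone_finiteSubcomplex (Adjunction.ofIsLeftAdjoint _) V⟩⟩
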